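/- All Banach spaces are over the same field $\mathbb F\in\{\mathbb R,\mathbb C\}$, and bases are indexed by countable sets. An unconditional basis of a Banach space $X$ is a countable family $(x_i)_{i\in N}$ in $X$, with biorthogonal functionals $(x_i^*)_{i\in N}$ in $X^*$, such that $f=\sum_{i} x_i^*(f)\,x_i$ unconditionally for every $f\in X$; the support of $f$ is $\{i: x_i^*(f)\neq 0\}$. For $0<q\le\infty$, such a basis satisfies an upper $q$-estimate (resp. a lower $q$-estimate) if there is a constant $C$ with $\|\sum_k f_k\|\le C(\sum_k\|f_k\|^q)^{1/q}$ (resp. $(\sum_k\|f_k\|^q)^{1/q}\le C\|\sum_k f_k\|$) for every finite family $(f_k)$ in $X$ of vectors with pairwise disjoint supports, where $(\sum_k\|f_k\|^q)^{1/q}$ means $\max_k\|f_k\|$ if $q=\infty$. The basis is semi-normalized if $0<\inf_i\|x_i\|$ and $\sup_i\|x_i\|<\infty$. Let $n\ge 1$. Unconditional bases $\mathcal B_1,\dots,\mathcal B_n$ of Banach spaces $X_1,\dots,X_n$ are called lattice-estimate disjoint if there is a non-decreasing sequence $(q_j)_{j=1}^{n-1}$ in $(0,\infty]$ such that for every $1\le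 j\le n-1$: $\mathcal B_j$ satisfies a lower $q_j$-estimate; $\mathcal B_{j+1}$ satisfies an upper $q_j$-estimate; and at least one of $X_j$, $X_{j+1}$ contains no subspace isomorphic to $\ell_{q_j}$ (where $\ell_\infty$ is to be read as $c_0$). A Banach space $X$ has a UTAP (unique up to a permutation) unconditional basis if it has a semi-normalized unconditional basis $\mathcal B$ and every semi-normalized unconditional basis of $X$ is equivalent to a permutation of $\mathcal B$, i.e. for every semi-normalized unconditional basis $(y_k)_{k\in M}$ of $X$, writing $\mathcal B=(x_i)_{i\in N}$, there are a bijection $\pi\colon N\to M$ and an isomorphism $T\colon X\to X$ with $T(x_i)=y_{\pi(i)}$ for all $i\in N$. **Theorem.** Let $X_1,\dots,X_n$ be Banach spaces with unconditional bases $\mathcal B_1,\dots,\mathcal B_n$, where $X_j$ is infinite-dimensional for $1<j<n$, and suppose that $(\mathcal B_j)_{j=1}^n$ is lattice-estimate disjoint. Then $(X_j)_{j=1}^n$ is splitting for unconditional bases: for every unconditional basis $(u_i)_{i\in N}$ of $\bigoplus_{j=1}^n X_j$ there is a partition of $N$ into (possibly empty) sets $N_1,\dots,N_n$ such that, for each $j$,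 the closed linear span of $(u_i)_{i\in N_j}$ is isomorphic to $X_j$. In particular, if each $X_j$ has a UTAP unconditional basis, then $\bigoplus_{j=1}^n X_j$ has a UTAP unconditional basis. -/

import Mathlib

open scoped ENNReal

noncomputable section

namespace SplitUB

section Bases

variable {𝕜 : Type*} [RCLike 𝕜] {X : Type*} [NormedAddCommGroup X] [NormedSpace 𝕜 X]
  {Y : Type*} [NormedAddCommGroup Y] [NormedSpace 𝕜 Y] {ι : Type*} {κ : Type*}

/-- The support of a vector with respect to an unconditional basis. -/
def supp (b : UnconditionalSchauderBasis ι 𝕜 X) (f : X) : Set ι :=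
  {i | b.coord i f ≠ 0}

/-- A finite family of vectors with pairwise disjoint supports. -/
def DisjointlySupported (b : UnconditionalSchauderBasis ι 𝕜 X) {m : ℕ} (f : Fin m → X) : Prop :=
  ∀ k l, k ≠ l → Disjoint (supp b (f k)) (supp b (f l))

/-- The lattice structure induced by the basis satisfies an upper `q`-estimate:
`‖∑ f k‖ ≤ C (∑ ‖f k‖ ^ q) ^ (1 / q)` for disjointly supported finite families
(with `max ‖f k‖` on the right if `q = ∞`). -/
def UpperEstimate (b : UnconditionalSchauderBasis ι 𝕜 X) (q : ℝ≥0∞) : Prop :=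
  ∃ C : ℝ, ∀ (m : ℕ) (f : Fin m → X), DisjointlySupported b f →
    ‖∑ k, f k‖ ≤ C * ‖(WithLp.toLp q f : PiLp q fun _ : Fin m => X)‖

/-- The lattice structure induced by the basis satisfies a lower `q`-estimate:
`(∑ ‖f k‖ ^ q) ^ (1 / q) ≤ C ‖∑ f k‖` for disjointly supported finite families
(with `max ‖f k‖` on the left if `q = ∞`). -/
def LowerEstimate (b : UnconditionalSchauderBasis ι 𝕜 X) (q : ℝ≥0∞) : Prop :=
  ∃ C : ℝ, ∀ (m : ℕ) (f : Fin m → X), DisjointlySupported b f →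
    ‖(WithLp.toLp q f : PiLp q fun _ : Fin m => X)‖ ≤ C * ‖∑ k, f k‖

/-- The basis vectors are bounded, and bounded away from zero. -/
def SemiNormalized (b : UnconditionalSchauderBasis ι 𝕜 X) : Prop :=
  ∃ c C : ℝ, 0 < c ∧ ∀ i, c ≤ ‖b i‖ ∧ ‖b i‖ ≤ C

/-- Two bases are equivalent up to a permutation: some isomorphism of the spaces
carries one basis onto a rearrangement of the other. -/
def PermEquivalent (b : UnconditionalSchauderBasis ι 𝕜 X)
    (b' : UnconditionalSchauderBasis κ 𝕜 Y) : Prop :=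
  ∃ (π : ι ≃ κ) (T : X ≃L[𝕜] Y), ∀ i, T (b i) = b' (π i)

end Bases

section Spaces

variable (𝕜 : Type*) [RCLike 𝕜]

/-- `X` has a closed subspace isomorphic to `ℓ_q`, where `ℓ_∞` is replaced with `c₀`.
The case `q < 1`, in which `ℓ_q` is only quasi-normed, is included; this is why for finite `q`
the two bounds of the embedding are spelled out. -/
def ContainsLq (X : Type*) [NormedAddCommGroup X] [NormedSpace 𝕜 X] (q : ℝ≥0∞) : Prop :=
  (q ≠ ∞ ∧ ∃ (T : lp (fun _ : ℕ => 𝕜) q →ₗ[𝕜] X) (c C : ℝ), 0 < c ∧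
    ∀ a, c * ‖a‖ ≤ ‖T a‖ ∧ ‖T a‖ ≤ C * ‖a‖) ∨
  (q = ∞ ∧ ∃ (T : ZeroAtInftyContinuousMap ℕ 𝕜 →ₗ[𝕜] X) (c C : ℝ), 0 < c ∧
    ∀ a, c * ‖a‖ ≤ ‖T a‖ ∧ ‖T a‖ ≤ C * ‖a‖)

/-- `X` has a UTAP (unique up to a permutation) unconditional basis: it has a semi-normalized
unconditional basis, and any other one is equivalent to a permutation of it. Bases are
countable families; a countable index set may be taken in `Type`. -/
def HasUTAPBasis (X : Type*) [NormedAddCommGroup X] [NormedSpace 𝕜 X] : Prop :=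
  ∃ (ι : Type) (_ : Countable ι) (b : UnconditionalSchauderBasis ι 𝕜 X), SemiNormalized b ∧
    ∀ (κ : Type) (_ : Countable κ) (b' : UnconditionalSchauderBasis κ 𝕜 X),
      SemiNormalized b' → PermEquivalent b b'

/-- Every unconditional basis of the direct sum of the `X j` can be partitioned into
subfamilies, one for each `j`, whose closed linear spans are isomorphic to the `X j`.
The map `σ` says to which part a basis vector belongs. -/
def SplittingForUnconditionalBases {J : Type*} [Fintype J] (X : J → Type*)
    [∀ j, NormedAddCommGroup (X j)] [∀ j, NormedSpace 𝕜 (X j)] : Prop :=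
  ∀ (ι : Type) (_ : Countable ι) (b : UnconditionalSchauderBasis ι 𝕜 (∀ j, X j)),
    ∃ σ : ι → J, ∀ j,
      Nonempty ((Submodule.span 𝕜 (b '' {i | σ i = j})).topologicalClosure ≃L[𝕜] X j)

end Spaces

/-- Lattice-estimate disjointness of bases `B 0, …, B n` of spaces `X 0, …, X n`. -/
def LatticeEstimateDisjoint {𝕜 : Type*} [RCLike 𝕜] {n : ℕ} {X : Fin (n + 1) → Type*}
    [∀ j, NormedAddCommGroup (X j)] [∀ j, NormedSpace 𝕜 (X j)] {ι : Fin (n + 1) → Type*}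
    (B : ∀ j, UnconditionalSchauderBasis (ι j) 𝕜 (X j)) : Prop :=
  ∃ q : Fin n → ℝ≥0∞, (∀ j, 0 < q j) ∧ Monotone q ∧ ∀ j : Fin n,
    LowerEstimate (B j.castSucc) (q j) ∧ UpperEstimate (B j.succ) (q j) ∧
    (¬ ContainsLq 𝕜 (X j.castSucc) (q j) ∨ ¬ ContainsLq 𝕜 (X j.succ) (q j))

end SplitUB

end

/-! The heart of the matter is that every operator from a later summand to an earlier one is
compact; splitting then follows from compactness alone.

Compactness is a Pitt-type argument. A noncompact `T : X k → X j` with `j < k` yields, by a gliding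
hump, disjointly supported vectors whose images are nearly disjoint and bounded below. The lower
estimate on `X j` and the upper estimate on `X k` then compare two sequence norms, which forces
their exponents to coincide, since the exponents are monotone. Both spaces therefore contain the
corresponding `ℓ_q`. If `k = j + 1` this contradicts disjointness; otherwise the exponents in
between are all equal, so the infinite-dimensional `X (j+1)` satisfies both `q`-estimates and
contains `ℓ_q` as well (`isCompactOperator_of_latticeEstimateDisjoint`).

For splitting, let `P` be the projection of `X × Y` onto `X`, `Q = 1 - P`, and let all operators `P
R Q` be compact. For each basis index the diagonal entry of `P` or that of `Q` has modulus at least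
1/2; this decides where the index goes. Averaging `ε P ε` over signs `ε` recovers the diagonal of
`P`. Compactness of `P ε Q` for each `ε`, made uniform by Baire category (`exists_uniform_net`),
shows that, off a finite set, the `P`-coordinates of the range of `Q` are small and `P` almost maps
bounded sets supported on the `Q`-indices into a compact set. A Neumann series then makes the
coordinate map from the range of `P` onto, with finite-dimensional kernel, and finitely many extra
indices repair the kernel (`exists_splitting_set`). Induction on the number of summands gives the
splitting, and isomorphisms of the parts are glued to give uniqueness of bases. -/

noncomputable section

namespace SplitUB

open Filter Topology Set

/-! ### Bounded multipliers of an unconditional basis. -/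

section Multipliers

variable {𝕜 : Type*} [RCLike 𝕜] {Z : Type*} [NormedAddCommGroup Z] [NormedSpace 𝕜 Z]
  {W : Type*} [NormedAddCommGroup W] [NormedSpace 𝕜 W] {ι : Type*} {κ : Type*}

lemma sum_abs_le_of_subset_sums {s : Finset ι} {r : ι → ℝ} {B : ℝ}
    (h : ∀ t ⊆ s, |∑ i ∈ t, r i| ≤ B) : ∑ i ∈ s, |r i| ≤ 2 * B := by
  classical
  have h1 := h (s.filter fun i => 0 ≤ r i) (Finset.filter_subset _ _)
  have h2 := h (s.filter fun i => ¬ 0 ≤ r i) (Finset.filter_subset _ _)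
  rw [← Finset.sum_filter_add_sum_filter_not s (fun i => 0 ≤ r i)]
  have e1 : ∑ i ∈ s.filter (fun i => 0 ≤ r i), |r i| = ∑ i ∈ s.filter (fun i => 0 ≤ r i), r i :=
    Finset.sum_congr rfl fun i hi => abs_of_nonneg (Finset.mem_filter.1 hi).2
  have e2 : ∑ i ∈ s.filter (fun i => ¬ 0 ≤ r i), |r i|
      = - ∑ i ∈ s.filter (fun i => ¬ 0 ≤ r i), r i := by
    rw [← Finset.sum_neg_distrib]
    exact Finset.sum_congr rfl fun i hi => abs_of_neg (not_le.1 (Finset.mem_filter.1 hi).2)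
  rw [e1, e2]
  linarith [abs_le.1 h1, abs_le.1 h2]

lemma norm_le_abs_re_add_abs_im (z : 𝕜) : ‖z‖ ≤ |RCLike.re z| + |RCLike.im z| := by
  conv_lhs => rw [← RCLike.re_add_im z]
  refine (norm_add_le _ _).trans ?_
  rw [norm_mul, RCLike.norm_ofReal, RCLike.norm_ofReal]
  gcongr
  refine mul_le_of_le_one_right (abs_nonneg _) ?_
  by_cases hI : (RCLike.I : 𝕜) = 0
  · simp [hI]
  · exact (RCLike.norm_I_of_ne_zero hI).le

/-- Bounded scalars increase the norm of a finite sum by at most four times their bound, relative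
to the largest partial sum. -/
lemma norm_sum_smul_le {s : Finset ι} {x : ι → Z} {μ : ι → 𝕜} {B C : ℝ} (hC : ∀ i, ‖μ i‖ ≤ C)
    (hC0 : 0 ≤ C) (h : ∀ t ⊆ s, ‖∑ i ∈ t, x i‖ ≤ B) : ‖∑ i ∈ s, μ i • x i‖ ≤ 4 * C * B := by
  -- A norming functional reduces the claim to scalar sums. The factor 4 is 2 for positive and
  -- negative terms times 2 for real and imaginary parts.
  obtain ⟨g, hg, hgx⟩ := exists_dual_vector'' 𝕜 (∑ i ∈ s, μ i • x i)
  have hg' : ∀ t ⊆ s, ‖∑ i ∈ t, g (x i)‖ ≤ B := fun t ht => by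
    rw [← map_sum]
    exact (g.le_of_opNorm_le hg _).trans (by simpa using h t ht)
  have hre : ∑ i ∈ s, |RCLike.re (g (x i))| ≤ 2 * B :=
    sum_abs_le_of_subset_sums fun t ht => by
      rw [← map_sum]; exact (RCLike.abs_re_le_norm _).trans (hg' t ht)
  have him : ∑ i ∈ s, |RCLike.im (g (x i))| ≤ 2 * B :=
    sum_abs_le_of_subset_sums fun t ht => by
      rw [← map_sum]; exact (RCLike.abs_im_le_norm _).trans (hg' t ht)
  have h1 : ‖∑ i ∈ s, μ i • x i‖ = ‖∑ i ∈ s, μ i * g (x i)‖ := by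
    have : g (∑ i ∈ s, μ i • x i) = ∑ i ∈ s, μ i * g (x i) := by simp [map_sum]
    rw [← this, hgx]; simp
  rw [h1]
  calc ‖∑ i ∈ s, μ i * g (x i)‖ ≤ ∑ i ∈ s, ‖μ i * g (x i)‖ := norm_sum_le _ _
    _ ≤ ∑ i ∈ s, C * (|RCLike.re (g (x i))| + |RCLike.im (g (x i))|) := by
        refine Finset.sum_le_sum fun i _ => ?_
        rw [norm_mul]
        exact mul_le_mul (hC i) (norm_le_abs_re_add_abs_im _) (norm_nonneg _) hC0
    _ = C * (∑ i ∈ s, |RCLike.re (g (x i))| + ∑ i ∈ s, |RCLike.im (g (x i))|) := by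
        rw [← Finset.sum_add_distrib, Finset.mul_sum]
    _ ≤ C * (2 * B + 2 * B) := by gcongr
    _ = 4 * C * B := by ring

section

variable {b : UnconditionalSchauderBasis ι 𝕜 Z}

lemma coord_self (i : ι) : b.coord i (b i) = 1 := by simp [b.ortho]

lemma coord_of_ne {i j : ι} (h : i ≠ j) : b.coord i (b j) = 0 := by
  simp [b.ortho, h]

lemma coord_hasSum {a : ι → 𝕜} {z : Z} (h : HasSum (fun i => a i • b i) z) (i : ι) :
    b.coord i z = a i := by
  have h1 := (b.coord i).hasSum h
  have h2 : HasSum (fun j => b.coord i (a j • b j)) (b.coord i (a i • b i)) :=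
    hasSum_single i fun j hj => by simp [coord_of_ne hj.symm]
  rw [h1.unique h2]; simp [coord_self]

lemma ext_coord {x y : Z} (h : ∀ i, b.coord i x = b.coord i y) : x = y := by
  have h1 := b.expansion x
  simp only [h] at h1
  exact h1.unique (b.expansion y)

open scoped Classical in
lemma coord_proj (s : Finset ι) (z : Z) (i : ι) :
    b.coord i (b.proj s z) = if i ∈ s then b.coord i z else 0 := by
  rw [b.proj_apply, map_sum]
  simp only [map_smul, smul_eq_mul]
  split_ifs with h
  · rw [Finset.sum_eq_single_of_mem i h fun j _ hj => by rw [coord_of_ne hj.symm, mul_zero],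
      coord_self, mul_one]
  · exact Finset.sum_eq_zero fun j hj => by
      rw [coord_of_ne fun e : i = j => h (by rwa [e]), mul_zero]

lemma exists_norm_sub_proj_le (z : Z) {δ : ℝ} (hδ : 0 < δ) :
    ∃ s : Finset ι, ∀ t, s ⊆ t → ‖z - b.proj t z‖ ≤ δ := by
  have h := b.tendsto_proj z
  rw [SummationFilter.unconditional_filter, Metric.tendsto_nhds] at h
  classical
  obtain ⟨s, hs⟩ := eventually_atTop.1 (h δ hδ)
  exact ⟨s, fun t ht => by
    have := hs t ht
    rw [dist_eq_norm, norm_sub_rev] at this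
    exact this.le⟩

end

variable (b : UnconditionalSchauderBasis ι 𝕜 Z)

/-- A constant which bounds all multipliers of a basis. -/
def multConst : ℝ := 4 * b.nnnormProjBound

lemma multConst_nonneg : 0 ≤ multConst b := by unfold multConst; positivity

variable [CompleteSpace Z]

lemma summable_smul_coord {μ : ι → 𝕜} {C : ℝ} (hC : ∀ i, ‖μ i‖ ≤ C) (z : Z) :
    Summable fun i => μ i • b.coord i z • b i := by
  classical
  have hC1 : ∀ i, ‖μ i‖ ≤ |C| := fun i => (hC i).trans (le_abs_self C)
  rw [summable_iff_vanishing_norm]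
  intro ε hε
  obtain ⟨s, hs⟩ := summable_iff_vanishing_norm.1 (b.expansion z).summable
    (ε / (4 * |C| + 1)) (by positivity)
  refine ⟨s, fun t ht => ?_⟩
  refine (norm_sum_smul_le hC1 (abs_nonneg C) fun u hu =>
    (hs u (ht.mono_left hu)).le).trans_lt ?_
  rw [← mul_div_assoc, div_lt_iff₀ (by positivity)]
  nlinarith [abs_nonneg C]

lemma norm_tsum_smul_coord_le {μ : ι → 𝕜} {C : ℝ} (hC0 : 0 ≤ C) (hC : ∀ i, ‖μ i‖ ≤ C) (z : Z) :
    ‖∑' i, μ i • b.coord i z • b i‖ ≤ multConst b * C * ‖z‖ := by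
  refine le_of_tendsto (summable_smul_coord b hC z).hasSum.norm
    (Eventually.of_forall fun s => ?_)
  refine (norm_sum_smul_le (B := b.nnnormProjBound * ‖z‖) hC hC0 fun t _ => ?_).trans_eq ?_
  · have := (b.proj t).le_of_opNorm_le (b.norm_proj_le_nnnormProjBound t) z
    simpa using this
  · unfold multConst; ring

open scoped Classical in
/-- The operator which multiplies the coordinates with respect to `b` by the scalars `μ i`
(zero if the scalars are unbounded). -/
def mult (μ : ι → 𝕜) : Z →L[𝕜] Z :=
  if h : ∃ C : ℝ, ∀ i, ‖μ i‖ ≤ C then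
    LinearMap.mkContinuous
      { toFun := fun z => ∑' i, μ i • b.coord i z • b i
        map_add' := fun x y => by
          rw [← (summable_smul_coord b h.choose_spec x).tsum_add
            (summable_smul_coord b h.choose_spec y)]
          simp [add_smul]
        map_smul' := fun c x => by
          rw [RingHom.id_apply, ← (summable_smul_coord b h.choose_spec x).tsum_const_smul]
          refine tsum_congr fun i => ?_
          rw [map_smul, smul_smul, smul_smul, smul_smul, smul_eq_mul]
          ring_nf }
      (multConst b * |h.choose|)
      (norm_tsum_smul_coord_le b (abs_nonneg _)
        fun i => (h.choose_spec i).trans (le_abs_self _))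
  else 0

variable {b}

lemma mult_apply {μ : ι → 𝕜} {C : ℝ} (hC : ∀ i, ‖μ i‖ ≤ C) (z : Z) :
    mult b μ z = ∑' i, μ i • b.coord i z • b i := by
  rw [mult, dif_pos ⟨C, hC⟩]; rfl

lemma norm_mult_apply_le {μ : ι → 𝕜} {C : ℝ} (hC0 : 0 ≤ C) (hC : ∀ i, ‖μ i‖ ≤ C) (z : Z) :
    ‖mult b μ z‖ ≤ multConst b * C * ‖z‖ := by
  rw [mult_apply hC]; exact norm_tsum_smul_coord_le b hC0 hC z

lemma coord_mult {μ : ι → 𝕜} {C : ℝ} (hC : ∀ i, ‖μ i‖ ≤ C) (z : Z) (i : ι) :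
    b.coord i (mult b μ z) = μ i * b.coord i z := by
  have h := (summable_smul_coord b hC z).hasSum
  rw [← mult_apply hC] at h
  exact coord_hasSum (a := fun i => μ i * b.coord i z) (by simpa only [mul_smul] using h) i

end Multipliers

/-! ### Sign multipliers: uniform nets and averaging. -/

section Averaging

variable {𝕜 : Type*} [RCLike 𝕜] {Z : Type*} [NormedAddCommGroup Z] [NormedSpace 𝕜 Z]
  {W : Type*} [NormedAddCommGroup W] [NormedSpace 𝕜 W] {ι : Type*}

variable (𝕜) in
/-- The scalars given by a family of signs. -/
def signs (θ : ι → SignType) (i : ι) : 𝕜 := (θ i : SignType)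

lemma norm_signs_le (θ : ι → SignType) (i : ι) : ‖signs 𝕜 θ i‖ ≤ 1 := by
  unfold signs
  rcases θ i with _ | _ | _ <;> simp [SignType.cast]

variable (𝕜) in
open scoped Classical in
/-- The indicator function of a set of indices. -/
def ind (A : Set ι) (i : ι) : 𝕜 := if i ∈ A then 1 else 0

lemma ind_of_mem {A : Set ι} {i : ι} (h : i ∈ A) : ind 𝕜 A i = 1 := if_pos h

lemma ind_of_notMem {A : Set ι} {i : ι} (h : i ∉ A) : ind 𝕜 A i = 0 := if_neg h

lemma norm_ind_le (A : Set ι) (i : ι) : ‖ind 𝕜 A i‖ ≤ 1 := by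
  unfold ind; split_ifs <;> simp

lemma continuous_signs (i : ι) : Continuous fun θ : ι → SignType => signs 𝕜 θ i := by
  have h : Continuous fun s : SignType => (s : 𝕜) := continuous_of_discreteTopology
  exact h.comp (continuous_apply i)

variable [CompleteSpace Z] {b : UnconditionalSchauderBasis ι 𝕜 Z}

lemma continuous_mult_signs (y : Z) : Continuous fun θ : ι → SignType => mult b (signs 𝕜 θ) y := by
  classical
  refine continuous_of_uniform_approx_of_continuous fun u hu => ?_
  obtain ⟨ε, hε, hεu⟩ := Metric.mem_uniformity_dist.1 hu
  have hc := multConst_nonneg b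
  obtain ⟨s, hs⟩ := exists_norm_sub_proj_le (b := b) y
    (δ := ε / (multConst b + 1)) (by positivity)
  refine ⟨fun θ => ∑ i ∈ s, signs 𝕜 θ i • b.coord i y • b i, ?_, fun θ => hεu ?_⟩
  · exact continuous_finsetSum _ fun i _ => (continuous_signs i).smul continuous_const
  · have e : ∑ i ∈ s, signs 𝕜 θ i • b.coord i y • b i = mult b (signs 𝕜 θ) (b.proj s y) := by
      refine ext_coord (b := b) fun j => ?_
      rw [coord_mult (norm_signs_le θ), coord_proj, map_sum]
      simp only [map_smul, smul_eq_mul]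
      split_ifs with h
      · rw [Finset.sum_eq_single_of_mem j h fun i _ hi => by rw [coord_of_ne hi.symm]; simp,
          coord_self, mul_one]
      · rw [mul_zero]
        exact Finset.sum_eq_zero fun i hi => by
          rw [coord_of_ne fun e : j = i => h (by rwa [e])]; simp
    rw [dist_eq_norm]
    change ‖_ - ∑ i ∈ s, signs 𝕜 θ i • b.coord i y • b i‖ < ε
    rw [e, ← map_sub]
    refine (norm_mult_apply_le zero_le_one (norm_signs_le θ) _).trans_lt ?_
    rw [mul_one]
    refine (mul_le_mul_of_nonneg_left (hs s subset_rfl) hc).trans_lt ?_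
    rw [← mul_div_assoc, div_lt_iff₀ (by positivity)]
    nlinarith

/-- If all images of `s` under `T` composed with sign multipliers are totally bounded, then
they are so uniformly, provided the multipliers vanish on a suitable finite set. -/
lemma exists_uniform_net [TopologicalSpace.SeparableSpace W] (T : Z →L[𝕜] W) (s : Set Z)
    (hT : ∀ θ : ι → SignType, TotallyBounded ((fun y => T (mult b (signs 𝕜 θ) y)) '' s))
    {δ : ℝ} (hδ : 0 < δ) :
    ∃ (F : Finset ι) (t : Finset W), ∀ θ : ι → SignType, (∀ i ∈ F, θ i = 0) → ∀ y ∈ s,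
      ∃ x ∈ t, ‖T (mult b (signs 𝕜 θ) y) - x‖ ≤ δ := by
  classical
  -- `C N` collects the signs for which the first `N` points of a dense sequence form a `δ / 2`-net
  -- of the image. These sets are closed and exhaust the compact space of signs, so by Baire one of
  -- them has interior.
  let x : ℕ → W := TopologicalSpace.denseSeq W
  let C : ℕ → Set (ι → SignType) := fun N =>
    {θ | ∀ y ∈ s, ∃ n ∈ Finset.range N, ‖T (mult b (signs 𝕜 θ) y) - x n‖ ≤ δ / 2}
  have hclosed : ∀ N, IsClosed (C N) := fun N => by
    have : C N = ⋂ y ∈ s, ⋃ n ∈ Finset.range N,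
        {θ | ‖T (mult b (signs 𝕜 θ) y) - x n‖ ≤ δ / 2} := by
      ext θ; simp [C]
    rw [this]
    refine isClosed_biInter fun y _ => isClosed_biUnion_finset fun n _ => ?_
    exact isClosed_le
      (((T.continuous.comp (continuous_mult_signs y)).sub continuous_const).norm) continuous_const
  have hunion : ⋃ N, C N = univ := by
    refine eq_univ_of_forall fun θ => mem_iUnion.2 ?_
    obtain ⟨c, hc, hcov⟩ := Metric.totallyBounded_iff.1 (hT θ) (δ / 4) (by positivity)
    have hx : ∀ w : W, ∃ n, ‖w - x n‖ < δ / 4 := fun w => by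
      obtain ⟨n, hn⟩ := (TopologicalSpace.denseRange_denseSeq W).exists_dist_lt w
        (by positivity : 0 < δ / 4)
      exact ⟨n, by rwa [dist_eq_norm] at hn⟩
    choose n hn using hx
    obtain ⟨N, hN⟩ := (hc.image n).bddAbove
    refine ⟨N + 1, fun y hy => ?_⟩
    obtain ⟨w, hw, hyw⟩ := mem_iUnion₂.1 (hcov (mem_image_of_mem _ hy))
    refine ⟨n w, Finset.mem_range.2 (Nat.lt_succ_of_le (hN (mem_image_of_mem n hw))), ?_⟩
    rw [Metric.mem_ball, dist_eq_norm] at hyw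
    have := norm_sub_le_norm_sub_add_norm_sub (T (mult b (signs 𝕜 θ) y)) w (x (n w))
    linarith [hn w]
  obtain ⟨N, θ₀, hθ₀⟩ := nonempty_interior_of_iUnion_of_closed hclosed hunion
  obtain ⟨F, u, hu, hFu⟩ := isOpen_pi_iff.1 isOpen_interior θ₀ hθ₀
  have hcyl : ∀ θ : ι → SignType, (∀ i ∈ F, θ i = θ₀ i) → θ ∈ C N := fun θ h =>
    interior_subset (hFu fun i hi => by rw [h i hi]; exact (hu i hi).2)
  refine ⟨F, (Finset.range N ×ˢ Finset.range N).image fun p => x p.1 - x p.2, fun θ hθ y hy => ?_⟩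
  -- Signs vanishing on `F` are differences of two members of the cylinder around `θ₀`; differences
  -- of net points then serve as net. The value 0 among the signs is what makes `θ₂` admissible.
  let θ₁ : ι → SignType := fun i => if i ∈ F then θ₀ i else θ i
  let θ₂ : ι → SignType := fun i => if i ∈ F then θ₀ i else 0
  obtain ⟨n, hn, hn'⟩ := hcyl θ₁ (fun i hi => by simp [θ₁, hi]) y hy
  obtain ⟨m, hm, hm'⟩ := hcyl θ₂ (fun i hi => by simp [θ₂, hi]) y hy
  refine ⟨x n - x m, Finset.mem_image.2 ⟨(n, m), Finset.mk_mem_product hn hm, rfl⟩, ?_⟩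
  have e : mult b (signs 𝕜 θ) y = mult b (signs 𝕜 θ₁) y - mult b (signs 𝕜 θ₂) y := by
    refine ext_coord (b := b) fun j => ?_
    rw [map_sub, coord_mult (norm_signs_le _), coord_mult (norm_signs_le _),
      coord_mult (norm_signs_le _), ← sub_mul]
    congr 1
    by_cases hj : j ∈ F
    · simp [signs, θ₁, θ₂, hj, hθ j hj]
    · simp [signs, θ₁, θ₂, hj]
  rw [e, map_sub, sub_sub_sub_comm]
  refine (norm_sub_le _ _).trans ?_
  linarith

open scoped Classical in
/-- The signs supported on `G` which are negative exactly on `η`. -/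
def flip (G η : Finset ι) (i : ι) : SignType := if i ∈ G then (if i ∈ η then -1 else 1) else 0

lemma sum_coord_flip (R : Z →L[𝕜] Z) (z : Z) (G : Finset ι) {j : ι} (hj : j ∈ G) :
    ∑ η ∈ G.powerset, b.coord j (mult b (signs 𝕜 (flip G η)) (R (mult b (signs 𝕜 (flip G η)) z)))
      = 2 ^ G.card * (b.coord j (R (b j)) * b.coord j z) := by
  classical
  set f : Finset ι → 𝕜 := fun η =>
    b.coord j (mult b (signs 𝕜 (flip G η)) (R (mult b (signs 𝕜 (flip G η)) z))) with hf
  -- Toggling `j` permutes the subsets of `G`. It changes the outer sign at `j` and only the `j`-th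
  -- inner coordinate, so in each pair the off-diagonal contributions cancel.
  have hbij : ∑ η ∈ G.powerset, f η = ∑ η ∈ G.powerset, f (symmDiff η {j}) := by
    refine Finset.sum_nbij' (fun η => symmDiff η {j}) (fun η => symmDiff η {j}) ?_ ?_ ?_ ?_ ?_
    · intro η hη
      rw [Finset.mem_powerset] at hη ⊢
      intro i hi
      rcases Finset.mem_symmDiff.1 hi with h | h
      · exact hη h.1
      · rw [Finset.mem_singleton.1 h.1]; exact hj
    · intro η hη
      rw [Finset.mem_powerset] at hη ⊢
      intro i hi
      rcases Finset.mem_symmDiff.1 hi with h | h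
      · exact hη h.1
      · rw [Finset.mem_singleton.1 h.1]; exact hj
    · intro η _; simp
    · intro η _; simp
    · intro η _; simp
  have hpair : ∀ η ∈ G.powerset, f η + f (symmDiff η {j})
      = 2 * (b.coord j (R (b j)) * b.coord j z) := by
    intro η _
    set σ : 𝕜 := signs 𝕜 (flip G η) j with hσ
    have hσ2 : σ * σ = 1 := by
      rw [hσ]; by_cases h : j ∈ η <;> simp [signs, flip, hj, h]
    have hσ' : signs 𝕜 (flip G (symmDiff η {j})) j = -σ := by
      rw [hσ]; by_cases h : j ∈ η <;> simp [signs, flip, hj, h, Finset.mem_symmDiff]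
    have hdiff : mult b (signs 𝕜 (flip G η)) z - mult b (signs 𝕜 (flip G (symmDiff η {j}))) z
        = (2 * σ * b.coord j z) • b j := by
      refine ext_coord (b := b) fun i => ?_
      rw [map_sub, coord_mult (norm_signs_le _), coord_mult (norm_signs_le _), map_smul,
        smul_eq_mul]
      by_cases hij : i = j
      · subst hij
        rw [hσ', coord_self]; ring
      · rw [coord_of_ne hij]
        have : signs 𝕜 (flip G (symmDiff η {j})) i = signs 𝕜 (flip G η) i := by
          simp [signs, flip, Finset.mem_symmDiff, hij]
        rw [this]; ring
    simp only [hf]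
    rw [coord_mult (norm_signs_le _), coord_mult (norm_signs_le _), hσ', ← hσ, neg_mul,
      ← sub_eq_add_neg, ← mul_sub, ← map_sub, ← map_sub, hdiff, map_smul, map_smul, smul_eq_mul]
    linear_combination (2 * b.coord j z * b.coord j (R (b j))) * hσ2
  have h2 : 2 * ∑ η ∈ G.powerset, f η
      = 2 * (2 ^ G.card * (b.coord j (R (b j)) * b.coord j z)) := by
    rw [two_mul]
    nth_rewrite 2 [hbij]
    rw [← Finset.sum_add_distrib, Finset.sum_congr rfl hpair, Finset.sum_const,
      Finset.card_powerset, nsmul_eq_mul]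
    push_cast; ring
  exact mul_left_cancel₀ two_ne_zero h2

/-- Averaging over signs replaces an operator by its diagonal part. -/
lemma sum_flip_eq (R : Z →L[𝕜] Z) {l : ι → 𝕜} {C : ℝ} (hC : ∀ i, ‖l i‖ ≤ C) {A : Set ι}
    (hl : ∀ i, l i * b.coord i (R (b i)) = ind 𝕜 A i) (G : Finset ι) (z : Z) :
    ∑ η ∈ G.powerset, mult b l (mult b (signs 𝕜 (flip G η)) (R (mult b (signs 𝕜 (flip G η)) z)))
      = (2 ^ G.card : 𝕜) • mult b (ind 𝕜 (A ∩ G)) z := by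
  refine ext_coord (b := b) fun j => ?_
  rw [map_sum, map_smul, coord_mult (norm_ind_le _), smul_eq_mul]
  simp only [coord_mult hC]
  rw [← Finset.mul_sum]
  by_cases hj : j ∈ G
  · rw [sum_coord_flip R z G hj]
    have : ind 𝕜 (A ∩ G) j = ind 𝕜 A j := by
      by_cases h : j ∈ A
      · rw [ind_of_mem h, ind_of_mem (A := A ∩ G) ⟨h, hj⟩]
      · rw [ind_of_notMem h, ind_of_notMem (A := A ∩ G) fun h1 => h h1.1]
    rw [this, ← hl]; ring
  · have : ind 𝕜 (A ∩ G) j = 0 := ind_of_notMem fun h => hj h.2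
    rw [this, Finset.sum_eq_zero]
    · simp
    · intro η _
      rw [coord_mult (norm_signs_le _)]
      simp [signs, flip, hj]

end Averaging

/-! ### Consequences of compactness of the operators `P R Q`. -/

section Splitting

variable {𝕜 : Type*} [RCLike 𝕜] {Z : Type*} [NormedAddCommGroup Z] [NormedSpace 𝕜 Z]
  {ι : Type*}

lemma separableSpace_of_basis [Countable ι] (b : UnconditionalSchauderBasis ι 𝕜 Z) :
    TopologicalSpace.SeparableSpace Z := by
  have h : TopologicalSpace.IsSeparable (Submodule.span 𝕜 (range b) : Set Z) :=
    (countable_range b).isSeparable.span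
  have h2 : closure (Submodule.span 𝕜 (range b) : Set Z) = univ := by
    refine eq_univ_of_forall fun z => ?_
    have ht := b.tendsto_proj z
    rw [SummationFilter.unconditional_filter] at ht
    refine mem_closure_of_tendsto ht (Eventually.of_forall fun s => ?_)
    rw [b.proj_apply]
    exact Submodule.sum_mem _ fun i _ => Submodule.smul_mem _ _
      (Submodule.subset_span (mem_range_self i))
  have h3 := h.closure
  rw [h2] at h3
  exact TopologicalSpace.isSeparable_univ_iff.1 h3

lemma totallyBounded_image_closedBall {T : Z →L[𝕜] Z} (hT : IsCompactOperator T) (r : ℝ) :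
    TotallyBounded (T '' Metric.closedBall 0 r) :=
  (hT.isCompact_closure_image_closedBall (f := (T : Z →ₗ[𝕜] Z)) r).totallyBounded.subset
    subset_closure

variable [CompleteSpace Z] {b : UnconditionalSchauderBasis ι 𝕜 Z}

/-- If the operators `P M Q` are compact and the diagonal of `P` is bounded away from zero
on `A`, then the coordinates in `A` of vectors in the range of `Q` have uniformly small tails. -/
lemma exists_norm_ind_tail_le [Countable ι] {P Q : Z →L[𝕜] Z}
    (hc : ∀ R : Z →L[𝕜] Z, IsCompactOperator (P ∘L R ∘L Q)) {l : ι → 𝕜} {C : ℝ} (hC0 : 0 ≤ C)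
    (hC : ∀ i, ‖l i‖ ≤ C) {A : Set ι}
    (hl : ∀ i, l i * b.coord i (P (b i)) = ind 𝕜 A i) {δ : ℝ} (hδ : 0 < δ) :
    ∃ F : Finset ι, ∀ w, ‖w‖ ≤ 1 → ‖mult b (ind 𝕜 (A \ F)) (Q w)‖ ≤ δ := by
  classical
  have := separableSpace_of_basis b
  set c := multConst b with hcdef
  have hc0 : 0 ≤ c := multConst_nonneg b
  -- Leaves room for one truncation error `δ₁` and the averaged bound `2 * (c * C * c) * δ₁`.
  set δ₁ := δ / (1 + 2 * (c * C * c)) with hδ₁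
  have hδ₁0 : 0 < δ₁ := by positivity
  obtain ⟨F₀, t, hF₀⟩ := exists_uniform_net (b := b) P (Q '' Metric.closedBall 0 1)
    (fun θ => by
      have := totallyBounded_image_closedBall (hc (mult b (signs 𝕜 θ))) 1
      rw [image_image]
      exact this) hδ₁0
  choose s hs using fun x : Z => exists_norm_sub_proj_le (b := b) x hδ₁0
  set F := F₀ ∪ t.biUnion s with hF
  have key : ∀ w, ‖w‖ ≤ 1 → ∀ G : Finset ι, Disjoint G F →
      ‖mult b (ind 𝕜 (A ∩ G)) (Q w)‖ ≤ 2 * (c * C * c) * δ₁ := by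
    intro w hw G hG
    have hterm : ∀ η ∈ G.powerset, ‖mult b l (mult b (signs 𝕜 (flip G η))
        (P (mult b (signs 𝕜 (flip G η)) (Q w))))‖ ≤ 2 * (c * C * c) * δ₁ := by
      intro η _
      obtain ⟨x, hx, hxP⟩ := hF₀ (flip G η) (fun i hi => by
        have : i ∉ G := fun h => Finset.disjoint_left.1 hG h (Finset.mem_union_left _ hi)
        simp [flip, this]) (Q w) (mem_image_of_mem _ (by simpa using hw))
      set v := P (mult b (signs 𝕜 (flip G η)) (Q w))
      -- The outer sign kills the head of the net point `x`, which lives on `F`; only the tail of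
      -- `x` and the net error remain.
      have hzero : mult b (signs 𝕜 (flip G η)) (b.proj F x) = 0 := by
        refine ext_coord (b := b) fun i => ?_
        rw [coord_mult (norm_signs_le _), coord_proj, map_zero]
        split_ifs with hi
        · have : i ∉ G := fun h => Finset.disjoint_left.1 hG h hi
          simp [signs, flip, this]
        · simp
      have hsplit : mult b (signs 𝕜 (flip G η)) v
          = mult b (signs 𝕜 (flip G η)) ((v - x) + (x - b.proj F x)) := by
        rw [sub_add_sub_cancel, map_sub, hzero, sub_zero]
      have hnorm : ‖(v - x) + (x - b.proj F x)‖ ≤ 2 * δ₁ := by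
        refine (norm_add_le _ _).trans ?_
        have := hs x F ((Finset.subset_biUnion_of_mem s hx).trans Finset.subset_union_right)
        linarith
      rw [hsplit]
      refine (norm_mult_apply_le hC0 hC _).trans ?_
      calc c * C * ‖mult b (signs 𝕜 (flip G η)) ((v - x) + (x - b.proj F x))‖
          ≤ c * C * (c * 1 * (2 * δ₁)) := by
            gcongr
            exact (norm_mult_apply_le zero_le_one (norm_signs_le _) _).trans (by gcongr)
        _ = 2 * (c * C * c) * δ₁ := by ring
    have h := sum_flip_eq P hC hl G (Q w)
    have h2 : ‖(2 ^ G.card : 𝕜) • mult b (ind 𝕜 (A ∩ G)) (Q w)‖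
        ≤ 2 ^ G.card * (2 * (c * C * c) * δ₁) := by
      rw [← h]
      refine (norm_sum_le_of_le _ hterm).trans ?_
      simp [Finset.card_powerset]
    rw [norm_smul, norm_pow, RCLike.norm_ofNat] at h2
    exact le_of_mul_le_mul_left h2 (by positivity)
  refine ⟨F, fun w hw => ?_⟩
  set v := mult b (ind 𝕜 (A \ F)) (Q w) with hv
  obtain ⟨t₀, ht₀⟩ := exists_norm_sub_proj_le (b := b) v hδ₁0
  have e : b.proj t₀ v = mult b (ind 𝕜 (A ∩ (t₀ \ F : Finset ι))) (Q w) := by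
    refine ext_coord (b := b) fun i => ?_
    rw [coord_proj, coord_mult (norm_ind_le _), coord_mult (norm_ind_le _)]
    by_cases h : i ∈ t₀ <;> by_cases h' : i ∈ A <;> by_cases h'' : i ∈ F <;>
      simp [ind, h, h', h'']
  have h1 := ht₀ t₀ subset_rfl
  rw [e] at h1
  have h2 := key w hw (t₀ \ F) Finset.sdiff_disjoint
  have h3 : ‖v‖ ≤ δ₁ + 2 * (c * C * c) * δ₁ := by
    have := norm_le_norm_sub_add v (mult b (ind 𝕜 (A ∩ (t₀ \ F : Finset ι))) (Q w))
    linarith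
  refine h3.trans_eq ?_
  rw [hδ₁]; field_simp

/-- If the operators `P M Q` are compact and the diagonal of `Q` is bounded away from zero
on `A`, then `P` almost maps bounded sets of vectors supported in `A`, off a finite set, into
a compact set. -/
lemma exists_isCompact_near [Countable ι] {P Q : Z →L[𝕜] Z}
    (hc : ∀ R : Z →L[𝕜] Z, IsCompactOperator (P ∘L R ∘L Q)) {l : ι → 𝕜} {C : ℝ}
    (hC : ∀ i, ‖l i‖ ≤ C) {A : Set ι}
    (hl : ∀ i, l i * b.coord i (Q (b i)) = ind 𝕜 A i) {δ : ℝ} (hδ : 0 < δ) (r : ℝ) :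
    ∃ (F : Finset ι) (K : Set Z), IsCompact K ∧ ∀ z, ‖z‖ ≤ r →
      (∀ i, i ∉ A ∨ i ∈ F → b.coord i z = 0) → ∃ k ∈ K, ‖P z - k‖ ≤ δ := by
  classical
  have := separableSpace_of_basis b
  obtain ⟨F, t, hF⟩ := exists_uniform_net (b := b) (P ∘L mult b l)
    (Q '' Metric.closedBall 0 (multConst b * 1 * r))
    (fun θ => by
      have := totallyBounded_image_closedBall (hc (mult b l ∘L mult b (signs 𝕜 θ)))
        (multConst b * 1 * r)
      rw [image_image]
      exact this) (half_pos hδ)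
  -- An average of net points, over however many signs, is a combination of the finitely many points
  -- of `t` with coefficients of modulus at most 1, so it lies in this compact set.
  let K : Set Z := (fun a : t → 𝕜 => ∑ x, a x • (x : Z)) '' univ.pi fun _ => Metric.closedBall 0 1
  have hK : IsCompact K := by
    refine (isCompact_univ_pi fun _ => isCompact_closedBall _ _).image ?_
    exact continuous_finsetSum _ fun x _ => (continuous_apply x).smul continuous_const
  refine ⟨F, K, hK, fun z hz hsupp => ?_⟩
  obtain ⟨t₀, ht₀⟩ := exists_norm_sub_proj_le (b := b) z
    (δ := δ / 2 / (‖P‖ + 1)) (by positivity)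
  set G := t₀ \ F with hG
  have e : b.proj t₀ z = mult b (ind 𝕜 (A ∩ G)) z := by
    refine ext_coord (b := b) fun i => ?_
    rw [coord_proj, coord_mult (norm_ind_le _)]
    by_cases h : i ∈ t₀ <;> by_cases h' : i ∈ A <;> by_cases h'' : i ∈ F
    all_goals first
      | (rw [hsupp i (by tauto)]; simp)
      | simp [ind, hG, h, h', h'']
  have hterm : ∀ η : Finset ι, ∃ x : t, ‖P (mult b l (mult b (signs 𝕜 (flip G η))
        (Q (mult b (signs 𝕜 (flip G η)) z)))) - x‖ ≤ δ / 2 := by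
    intro η
    obtain ⟨x, hx, hxP⟩ := hF (flip G η) (fun i hi => by simp [flip, hG, hi])
      (Q (mult b (signs 𝕜 (flip G η)) z)) (mem_image_of_mem _ (by
        rw [mem_closedBall_zero_iff]
        refine (norm_mult_apply_le zero_le_one (norm_signs_le _) _).trans ?_
        have := multConst_nonneg b
        gcongr))
    exact ⟨⟨x, hx⟩, hxP⟩
  choose x hx using hterm
  set N : 𝕜 := 2 ^ G.card with hN
  have hNn : ‖N‖ = 2 ^ G.card := by rw [hN, norm_pow, RCLike.norm_ofNat]
  have hN0 : N ≠ 0 := by rw [hN]; exact pow_ne_zero _ two_ne_zero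
  have hsum := congrArg P (sum_flip_eq Q hC hl G z)
  rw [map_sum, map_smul, ← e, ← hN] at hsum
  set k : Z := N⁻¹ • ∑ η ∈ G.powerset, (x η : Z) with hk
  have hkK : k ∈ K := by
    -- The coefficient of `y` is the proportion of sign choices whose net point is `y`.
    refine ⟨fun y => N⁻¹ * ((G.powerset.filter fun η => x η = y).card : 𝕜), ?_, ?_⟩
    · intro y _
      rw [mem_closedBall_zero_iff, norm_mul, norm_inv, hNn, RCLike.norm_natCast,
        inv_mul_le_iff₀ (by positivity), mul_one]
      have := Finset.card_filter_le G.powerset fun η => x η = y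
      rw [Finset.card_powerset] at this
      exact_mod_cast this
    · simp only [hk]
      rw [← Finset.sum_fiberwise G.powerset x, Finset.smul_sum]
      refine Finset.sum_congr rfl fun y _ => ?_
      rw [mul_smul, Nat.cast_smul_eq_nsmul, ← Finset.sum_const]
      congr 1
      exact Finset.sum_congr rfl fun η hη => by rw [(Finset.mem_filter.1 hη).2]
  refine ⟨k, hkK, ?_⟩
  have h1 : ‖P (b.proj t₀ z) - k‖ ≤ δ / 2 := by
    have : P (b.proj t₀ z) - k = N⁻¹ • ∑ η ∈ G.powerset, (P (mult b l
        (mult b (signs 𝕜 (flip G η)) (Q (mult b (signs 𝕜 (flip G η)) z)))) - x η) := by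
      rw [Finset.sum_sub_distrib, hsum, smul_sub, smul_smul, inv_mul_cancel₀ hN0, one_smul]
    rw [this, norm_smul, norm_inv, hNn, inv_mul_le_iff₀ (by positivity)]
    refine (norm_sum_le_of_le _ fun η _ => hx η).trans ?_
    simp [Finset.card_powerset]
  have h2 : ‖P z - P (b.proj t₀ z)‖ ≤ δ / 2 := by
    rw [← map_sub]
    refine (P.le_opNorm _).trans ((mul_le_mul_of_nonneg_left (ht₀ t₀ subset_rfl)
      (norm_nonneg _)).trans ?_)
    rw [← mul_div_assoc, div_le_iff₀ (by positivity)]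
    nlinarith [norm_nonneg P]
  have := norm_sub_le_norm_sub_add_norm_sub (P z) (P (b.proj t₀ z)) k
  linarith

end Splitting

/-! ### Splitting a direct sum of two spaces. -/

section TwoSummands

/-- A maximal linearly independent subfamily of a separating family of functionals is still
separating, hence a basis of the dual; its indices form `H`. -/
lemma exists_coordinates_bijective {𝕜 V ι : Type*} [Field 𝕜] [AddCommGroup V] [Module 𝕜 V]
    [FiniteDimensional 𝕜 V] (φ : ι → Module.Dual 𝕜 V) (hsep : ∀ v, (∀ i, φ i v = 0) → v = 0) :
    ∃ H : Set ι, (∀ v, (∀ i ∈ H, φ i v = 0) → v = 0) ∧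
      ∀ a : ι → 𝕜, ∃ v, ∀ i ∈ H, φ i v = a i := by
  obtain ⟨κ, f, hf, hspan, hind⟩ := exists_linearIndependent' 𝕜 φ
  have : Finite κ := hind.finite
  have : Fintype κ := Fintype.ofFinite κ
  have hsepκ : ∀ v, (∀ k, φ (f k) v = 0) → v = 0 := fun v hv => hsep v fun i => by
    have hi : φ i ∈ Submodule.span 𝕜 (range (φ ∘ f)) := by
      rw [hspan]; exact Submodule.subset_span (mem_range_self i)
    have hle : Submodule.span 𝕜 (range (φ ∘ f)) ≤ LinearMap.ker (Module.Dual.eval 𝕜 V v) := by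
      rw [Submodule.span_le]
      rintro _ ⟨k, rfl⟩
      simpa using hv k
    simpa using hle hi
  let Φ : V →ₗ[𝕜] κ → 𝕜 := LinearMap.pi fun k => φ (f k)
  have hinj : Function.Injective Φ := by
    rw [injective_iff_map_eq_zero]
    exact fun v hv => hsepκ v fun k => congrFun hv k
  have hcard : Module.finrank 𝕜 V = Module.finrank 𝕜 (κ → 𝕜) := by
    refine le_antisymm (LinearMap.finrank_le_finrank_of_injective hinj) ?_
    rw [Module.finrank_fintype_fun_eq_card, ← Subspace.dual_finrank_eq]
    exact hind.fintype_card_le_finrank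
  have hsurj := (LinearMap.injective_iff_surjective_of_finrank_eq_finrank hcard).1 hinj
  refine ⟨range f, fun v hv => hsepκ v fun k => hv _ (mem_range_self k), fun a => ?_⟩
  obtain ⟨v, hv⟩ := hsurj fun k => a (f k)
  refine ⟨v, ?_⟩
  rintro _ ⟨k, rfl⟩
  exact congrFun hv k

lemma finiteDimensional_of_ker {𝕜 V V' : Type*} [Field 𝕜] [AddCommGroup V] [Module 𝕜 V]
    [AddCommGroup V'] [Module 𝕜 V'] [FiniteDimensional 𝕜 V'] (f : V →ₗ[𝕜] V')
    (h : FiniteDimensional 𝕜 (LinearMap.ker f)) : FiniteDimensional 𝕜 V := by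
  have : Module.Finite 𝕜 (V ⧸ LinearMap.ker f) :=
    Module.Finite.equiv f.quotKerEquivRange.symm
  exact Module.Finite.of_submodule_quotient (LinearMap.ker f)

variable {𝕜 : Type*} [RCLike 𝕜] {Z : Type*} [NormedAddCommGroup Z] [NormedSpace 𝕜 Z]
  {ι : Type*}

/-- By Riesz, an infinite-dimensional `E` contains a 1-separated sequence in the ball of radius 3.
Along a subsequence its approximants in `K` get within 1/4 of each other, so two of its terms are at
distance less than 3/4. -/
lemma finiteDimensional_of_near_isCompact {E : Submodule 𝕜 Z} {K : Set Z} (hK : IsCompact K)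
    (h : ∀ x ∈ E, ‖x‖ ≤ 3 → ∃ k ∈ K, ‖x - k‖ ≤ 1 / 4) : FiniteDimensional 𝕜 E := by
  by_contra hfin
  obtain ⟨f, hf, hsep⟩ := exists_seq_norm_le_one_le_norm_sub' (𝕜 := 𝕜) (E := E) (c := 2)
    (by rw [RCLike.norm_ofNat]; norm_num) (R := 3) (by rw [RCLike.norm_ofNat]; norm_num) hfin
  choose k hkK hk using fun n => h (f n) (f n).2 (hf n)
  obtain ⟨a, -, φ, hφ, hlim⟩ := hK.tendsto_subseq hkK
  have hC := hlim.cauchySeq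
  obtain ⟨N, hN⟩ := Metric.cauchySeq_iff.1 hC (1 / 4) (by norm_num)
  have h1 := hN N le_rfl (N + 1) (Nat.le_succ N)
  rw [dist_eq_norm] at h1
  simp only [Function.comp] at h1
  have h2 : 1 ≤ ‖(f (φ N) : Z) - f (φ (N + 1))‖ := hsep (hφ.injective.ne (Nat.lt_succ_self N).ne)
  have h3 := hk (φ N)
  have h4 := hk (φ (N + 1))
  have e : (f (φ N) : Z) - f (φ (N + 1)) = (f (φ N) - k (φ N)) + (k (φ N) - k (φ (N + 1)))
      - (f (φ (N + 1)) - k (φ (N + 1))) := by abel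
  rw [e] at h2
  have h5 := norm_sub_le ((f (φ N) - k (φ N)) + (k (φ N) - k (φ (N + 1))))
    (f (φ (N + 1)) - k (φ (N + 1)))
  have h6 := norm_add_le (f (φ N) - k (φ N)) (k (φ N) - k (φ (N + 1)))
  linarith

/-- The closed subspace of all vectors supported in `A`. -/
def sub (b : UnconditionalSchauderBasis ι 𝕜 Z) (A : Set ι) : Submodule 𝕜 Z where
  carrier := {z | ∀ i ∉ A, b.coord i z = 0}
  add_mem' hx hy i hi := by rw [map_add, hx i hi, hy i hi, add_zero]
  zero_mem' i _ := map_zero _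
  smul_mem' c x hx i hi := by rw [map_smul, hx i hi, smul_zero]

lemma mem_sub {b : UnconditionalSchauderBasis ι 𝕜 Z} {A : Set ι} {z : Z} :
    z ∈ sub b A ↔ ∀ i ∉ A, b.coord i z = 0 := Iff.rfl

lemma isClosed_sub (b : UnconditionalSchauderBasis ι 𝕜 Z) (A : Set ι) :
    IsClosed (sub b A : Set Z) := by
  have : (sub b A : Set Z) = ⋂ i ∈ Aᶜ, {z | b.coord i z = 0} := by
    ext z; simp [mem_sub]
  rw [this]
  exact isClosed_biInter fun i _ => isClosed_eq (b.coord i).continuous continuous_const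

lemma basis_mem_sub {b : UnconditionalSchauderBasis ι 𝕜 Z} {A : Set ι} {i : ι} (hi : i ∈ A) :
    b i ∈ sub b A := fun _ hj => coord_of_ne fun e => hj (e ▸ hi)

/-- Closed spans of subfamilies can thus be handled through vanishing coordinates. -/
lemma topologicalClosure_span_eq_sub (b : UnconditionalSchauderBasis ι 𝕜 Z) (A : Set ι) :
    (Submodule.span 𝕜 (b '' A)).topologicalClosure = sub b A := by
  refine le_antisymm (Submodule.topologicalClosure_minimal _ ?_ (isClosed_sub b A)) fun z hz => ?_
  · rw [Submodule.span_le]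
    rintro _ ⟨i, hi, rfl⟩
    exact basis_mem_sub hi
  · have ht := b.tendsto_proj z
    rw [SummationFilter.unconditional_filter] at ht
    refine mem_closure_of_tendsto ht (Eventually.of_forall fun s => ?_)
    rw [b.proj_apply]
    refine Submodule.sum_mem _ fun i _ => ?_
    by_cases hi : i ∈ A
    · exact Submodule.smul_mem _ _ (Submodule.subset_span (mem_image_of_mem _ hi))
    · rw [hz i hi, zero_smul]; exact Submodule.zero_mem _

variable [CompleteSpace Z] {b : UnconditionalSchauderBasis ι 𝕜 Z}

/-- The splitting of an unconditional basis along a projection `P` such that the operators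
from the kernel of `P` to its range are compact. -/
lemma exists_splitting_set [Countable ι] {P : Z →L[𝕜] Z} (hP : ∀ z, P (P z) = P z)
    (hc : ∀ R : Z →L[𝕜] Z, IsCompactOperator (P ∘L R ∘L (1 - P))) :
    ∃ A : Set ι, (∀ x, P x = x → (∀ i ∈ A, b.coord i x = 0) → x = 0) ∧
      ∀ w : Z, ∃ x, P x = x ∧ ∀ i ∈ A, b.coord i x = b.coord i w := by
  classical
  set Q : Z →L[𝕜] Z := 1 - P with hQ
  have hPQ : ∀ z, Q z = z - P z := fun z => by simp [hQ]
  let d : ι → 𝕜 := fun i => b.coord i (P (b i))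
  have hd : ∀ i, b.coord i (Q (b i)) = 1 - d i := fun i => by
    rw [hPQ, map_sub, coord_self]
  let N₁ : Set ι := {i | 1 / 2 ≤ ‖d i‖}
  have hd₁ : ∀ i ∈ N₁, 1 / 2 ≤ ‖d i‖ := fun i hi => hi
  have hd₂ : ∀ i ∉ N₁, 1 / 2 ≤ ‖1 - d i‖ := fun i hi => by
    have h1 : ‖d i‖ < 1 / 2 := not_le.1 hi
    have h2 := norm_sub_norm_le (1 : 𝕜) (d i)
    rw [norm_one] at h2
    linarith
  have hinv : ∀ a : 𝕜, 1 / 2 ≤ ‖a‖ → ‖a⁻¹‖ ≤ 2 ∧ a⁻¹ * a = 1 := fun a ha => by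
    have ha0 : a ≠ 0 := norm_pos_iff.1 (by linarith)
    refine ⟨?_, inv_mul_cancel₀ ha0⟩
    rw [norm_inv]
    exact inv_le_of_inv_le₀ (by norm_num) (by linarith)
  let l₁ : ι → 𝕜 := fun i => if i ∈ N₁ then (d i)⁻¹ else 0
  let l₂ : ι → 𝕜 := fun i => if i ∈ N₁ then 0 else (1 - d i)⁻¹
  have hl₁ : ∀ i, ‖l₁ i‖ ≤ 2 := fun i => by
    by_cases h : i ∈ N₁
    · simpa [l₁, h] using (hinv _ (hd₁ i h)).1
    · simp [l₁, h]
  have hl₂ : ∀ i, ‖l₂ i‖ ≤ 2 := fun i => by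
    by_cases h : i ∈ N₁
    · simp [l₂, h]
    · simpa [l₂, h] using (hinv _ (hd₂ i h)).1
  have hl₁' : ∀ i, l₁ i * b.coord i (P (b i)) = ind 𝕜 N₁ i := fun i => by
    by_cases h : i ∈ N₁
    · simpa [l₁, h, ind_of_mem h] using (hinv _ (hd₁ i h)).2
    · simp [l₁, h, ind_of_notMem h]
  have hl₂' : ∀ i, l₂ i * b.coord i (Q (b i)) = ind 𝕜 N₁ᶜ i := fun i => by
    rw [hd]
    by_cases h : i ∈ N₁
    · rw [ind_of_notMem (A := N₁ᶜ) (not_not.2 h)]; simp [l₂, h]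
    · rw [ind_of_mem (A := N₁ᶜ) h]; simpa [l₂, h] using (hinv _ (hd₂ i h)).2
  obtain ⟨F, hF⟩ := exists_norm_ind_tail_le hc zero_le_two hl₁ hl₁' (δ := 1 / 2) (by norm_num)
  set A : Set ι := N₁ \ F with hA
  -- the coordinates in `A` of vectors in the range of `P` are arbitrary
  have hsurj : ∀ w : Z, ∃ x, P x = x ∧ ∀ i ∈ A, b.coord i x = b.coord i w := by
    intro w
    set S := mult b (ind 𝕜 A) with hS
    have hnorm : ‖S ∘L Q‖ < 1 := by
      refine lt_of_le_of_lt (ContinuousLinearMap.opNorm_le_bound _ (M := 1 / 2)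
        (by norm_num) fun x => ?_) (by norm_num : (1 : ℝ) / 2 < 1)
      rcases eq_or_ne x 0 with rfl | hx
      · simp
      · have h := hF ((‖x‖⁻¹ : 𝕜) • x) (norm_smul_inv_norm hx).le
        rw [map_smul, map_smul, norm_smul, norm_inv, RCLike.norm_ofReal, abs_norm,
          inv_mul_le_iff₀ (norm_pos_iff.2 hx), mul_comm] at h
        exact h
    -- A Neumann series solves `v - S (Q v) = S w`. On `A`, where `S` keeps coordinates, this says
    -- that `P v = v - Q v` has the coordinates of `w`.
    obtain ⟨U, hU⟩ := isUnit_one_sub_of_norm_lt_one (x := (S ∘L Q : Z →L[𝕜] Z)) hnorm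
    set v := (↑U⁻¹ : Z →L[𝕜] Z) (S w) with hv
    have hv1 : v - S (Q v) = S w := by
      have : (U : Z →L[𝕜] Z) v = S w := by
        rw [hv, ← mul_apply_eq_comp, Units.mul_inv]; rfl
      rw [hU] at this
      simpa using this
    refine ⟨P v, hP v, fun i hi => ?_⟩
    have h1 := congrArg (b.coord i) hv1
    rw [map_sub, coord_mult (norm_ind_le _), coord_mult (norm_ind_le _), ind_of_mem hi, one_mul,
      one_mul, hPQ, map_sub] at h1
    rw [← h1]; ring
  -- the kernel is finite dimensional
  let G : Submodule 𝕜 Z :=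
    { carrier := {x | P x = x ∧ ∀ i ∈ A, b.coord i x = 0}
      add_mem' := fun hx hy => ⟨by rw [map_add, hx.1, hy.1], fun i hi => by
        rw [map_add, hx.2 i hi, hy.2 i hi, add_zero]⟩
      zero_mem' := ⟨map_zero _, fun i _ => map_zero _⟩
      smul_mem' := fun c x hx => ⟨by rw [map_smul, hx.1], fun i hi => by
        rw [map_smul, hx.2 i hi, smul_zero]⟩ }
  obtain ⟨F', K, hK, hFK⟩ := exists_isCompact_near hc hl₂ hl₂' (δ := 1 / 4) (by norm_num) 3
  have hGfin : FiniteDimensional 𝕜 G := by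
    -- It suffices to treat the vectors of `G` that also vanish on `F ∪ F'`. These are supported in
    -- `N₁ᶜ` off `F'`, and `P` fixes them, so their bounded sets are near a compact set.
    let f : G →ₗ[𝕜] (F ∪ F' : Finset ι) → 𝕜 :=
      LinearMap.pi fun i => (b.coord i).toLinearMap ∘ₗ G.subtype
    refine finiteDimensional_of_ker f ?_
    have hfin : FiniteDimensional 𝕜 ((LinearMap.ker f).map G.subtype) := by
      refine finiteDimensional_of_near_isCompact hK ?_
      rintro _ ⟨x, hx, rfl⟩ hx3
      obtain ⟨k, hk, hxk⟩ := hFK x hx3 fun i hi => by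
        by_cases hiF : i ∈ F ∪ F'
        · exact congrFun (LinearMap.mem_ker.1 hx) ⟨i, hiF⟩
        · refine x.2.2 i ⟨?_, fun h => hiF (Finset.mem_union_left _ h)⟩
          rcases hi with hi | hi
          · exact not_not.1 hi
          · exact absurd (Finset.mem_union_right _ hi) hiF
      rw [x.2.1] at hxk
      exact ⟨k, hk, hxk⟩
    exact Module.Finite.equiv
      (Submodule.equivMapOfInjective G.subtype G.injective_subtype (LinearMap.ker f)).symm
  obtain ⟨H, hH, hH'⟩ := exists_coordinates_bijective
    (fun i => (b.coord i).toLinearMap ∘ₗ G.subtype) (fun v hv => by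
      refine Subtype.ext (ext_coord (b := b) fun i => ?_)
      rw [ZeroMemClass.coe_zero, map_zero]
      exact hv i)
  -- The coordinates in `H` determine vectors of `G` and can be prescribed on it, and correcting by
  -- `G` leaves those in `A` unchanged.
  refine ⟨A ∪ H, fun x hx hx0 => ?_, fun w => ?_⟩
  · have := hH ⟨x, hx, fun i hi => hx0 i (Or.inl hi)⟩ fun i hi => hx0 i (Or.inr hi)
    exact congrArg Subtype.val this
  · obtain ⟨x, hx, hxw⟩ := hsurj w
    obtain ⟨g, hg⟩ := hH' fun i => b.coord i (w - x)
    have hg' : ∀ i ∈ H, b.coord i (g : Z) = b.coord i (w - x) := hg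
    refine ⟨x + g, by rw [map_add, hx, g.2.1], ?_⟩
    rintro i (hi | hi)
    · rw [map_add, g.2.2 i hi, add_zero, hxw i hi]
    · rw [map_add, hg' i hi, map_sub]; ring

/-- If all operators from `Y` to `X` are compact, then any unconditional basis of `X × Y`
splits into a basis of a copy of `X` and a basis of a copy of `Y`. -/
theorem exists_splitting_prod {X Y : Type*} [NormedAddCommGroup X] [NormedSpace 𝕜 X]
    [NormedAddCommGroup Y] [NormedSpace 𝕜 Y] [CompleteSpace X] [CompleteSpace Y] [Countable ι]
    (b : UnconditionalSchauderBasis ι 𝕜 (X × Y))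
    (hc : ∀ T : Y →L[𝕜] X, IsCompactOperator T) :
    ∃ A : Set ι, Nonempty (sub b A ≃L[𝕜] X) ∧ Nonempty (sub b Aᶜ ≃L[𝕜] Y) := by
  let P : X × Y →L[𝕜] X × Y :=
    ContinuousLinearMap.inl 𝕜 X Y ∘L ContinuousLinearMap.fst 𝕜 X Y
  have hPa : ∀ z : X × Y, P z = (z.1, 0) := fun z => rfl
  obtain ⟨A, hA, hA'⟩ := exists_splitting_set (b := b) (P := P) (fun z => rfl) fun R => by
    have e : (P ∘L R ∘L (1 - P)) = ContinuousLinearMap.inl 𝕜 X Y ∘L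
        ((ContinuousLinearMap.fst 𝕜 X Y ∘L R ∘L ContinuousLinearMap.inr 𝕜 X Y) ∘L
          ContinuousLinearMap.snd 𝕜 X Y) := by
      refine ContinuousLinearMap.ext fun z => ?_
      have hz : z - P z = (0, z.2) := by simp [hPa, Prod.ext_iff]
      change P (R (z - P z)) = ((R (0, z.2)).1, 0)
      rw [hz, hPa]
    rw [e]
    exact IsCompactOperator.clm_comp (IsCompactOperator.comp_clm (hc
      (ContinuousLinearMap.fst 𝕜 X Y ∘L R ∘L ContinuousLinearMap.inr 𝕜 X Y))
      (ContinuousLinearMap.snd 𝕜 X Y)) (ContinuousLinearMap.inl 𝕜 X Y)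
  have hcl : ∀ B : Set ι, CompleteSpace (sub b B) := fun B =>
    (isClosed_sub b B).completeSpace_coe
  refine ⟨A, ⟨?_⟩, ⟨?_⟩⟩
  · have hmem : ∀ z, mult b (ind 𝕜 A) z ∈ sub b A := fun z i hi => by
      rw [coord_mult (norm_ind_le _), ind_of_notMem hi, zero_mul]
    have := hcl A
    refine (ContinuousLinearEquiv.ofBijective (((mult b (ind 𝕜 A)) ∘L
      ContinuousLinearMap.inl 𝕜 X Y).codRestrict (sub b A) fun x => hmem _) ?_ ?_).symm
    · refine LinearMap.ker_eq_bot'.2 fun x hx => ?_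
      have h0 : mult b (ind 𝕜 A) (x, 0) = 0 := congrArg Subtype.val hx
      have := hA (x, 0) rfl fun i hi => by
        have := congrArg (b.coord i) h0
        rwa [coord_mult (norm_ind_le _), ind_of_mem hi, one_mul, map_zero] at this
      exact congrArg Prod.fst this
    · refine LinearMap.range_eq_top.2 fun w => ?_
      obtain ⟨x, hx, hxw⟩ := hA' w
      refine ⟨x.1, Subtype.ext (ext_coord (b := b) fun i => ?_)⟩
      change b.coord i (mult b (ind 𝕜 A) (x.1, 0)) = _
      rw [hPa] at hx
      rw [hx, coord_mult (norm_ind_le _)]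
      by_cases hi : i ∈ A
      · rw [ind_of_mem hi, one_mul, hxw i hi]
      · rw [ind_of_notMem hi, zero_mul, w.2 i hi]
  · have := hcl Aᶜ
    -- The range of `P` is complementary to `sub b Aᶜ` as well as to `Y`, so projecting along it
    -- identifies the two.
    refine ContinuousLinearEquiv.ofBijective
      (ContinuousLinearMap.snd 𝕜 X Y ∘L (sub b Aᶜ).subtypeL) ?_ ?_
    · refine LinearMap.ker_eq_bot'.2 fun w hw => ?_
      have hw' : (w : X × Y).2 = 0 := hw
      exact Subtype.ext (hA w (Prod.ext rfl hw'.symm) fun i hi => w.2 i (not_not.2 hi))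
    · refine LinearMap.range_eq_top.2 fun y => ?_
      obtain ⟨x, hx, hxy⟩ := hA' (0, y)
      refine ⟨⟨(0, y) - x, fun i hi => ?_⟩, ?_⟩
      · rw [map_sub, hxy i (not_not.1 hi), sub_self]
      · have : x.2 = 0 := (congrArg Prod.snd hx).symm
        change ((0, y) - x).2 = y
        simp [this]

end TwoSummands

/-! ### Transport and restriction of bases. -/

section Transport

variable {𝕜 : Type*} [RCLike 𝕜] {Z : Type*} [NormedAddCommGroup Z] [NormedSpace 𝕜 Z]
  {W : Type*} [NormedAddCommGroup W] [NormedSpace 𝕜 W] {ι : Type*}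

/-- The image of a basis under an isomorphism. -/
def mapBasis (b : UnconditionalSchauderBasis ι 𝕜 Z) (e : Z ≃L[𝕜] W) :
    UnconditionalSchauderBasis ι 𝕜 W where
  basis i := e (b i)
  coord i := b.coord i ∘L (e.symm : W →L[𝕜] Z)
  ortho i j := by simp [b.ortho]
  expansion x := by
    have h := (e : Z →L[𝕜] W).hasSum (b.expansion (e.symm x))
    simpa using h

/-- The subfamily of a basis with indices in `A`, as a basis of its closed linear span. -/
def restrictBasis (b : UnconditionalSchauderBasis ι 𝕜 Z) (A : Set ι) :
    UnconditionalSchauderBasis A 𝕜 (sub b A) where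
  basis i := ⟨b i, basis_mem_sub i.2⟩
  coord i := b.coord i ∘L (sub b A).subtypeL
  ortho i j := by
    classical
    change b.coord i (b j) = _
    rw [b.ortho]
    simp [Pi.single_apply, Subtype.ext_iff]
  expansion x := by
    have h := b.expansion (x : Z)
    rw [← hasSum_subtype_iff_of_support_subset (s := A) (fun i hi => by
      by_contra hiA
      exact hi (by simp [x.2 i hiA]))] at h
    exact (Topology.IsInducing.hasSum_iff (g := (sub b A).subtype)
      Topology.IsInducing.subtypeVal _ _).1 h

/-- Vectors supported in `A` correspond under the transport of a basis. -/
def subMapEquiv (b : UnconditionalSchauderBasis ι 𝕜 Z) (e : Z ≃L[𝕜] W) (A : Set ι) :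
    sub b A ≃L[𝕜] sub (mapBasis b e) A :=
  ContinuousLinearEquiv.equivOfInverse
    (((e : Z →L[𝕜] W) ∘L (sub b A).subtypeL).codRestrict _ fun x i hi => by
      simpa [mapBasis] using x.2 i hi)
    (((e.symm : W →L[𝕜] Z) ∘L (sub (mapBasis b e) A).subtypeL).codRestrict _ fun x i hi =>
      x.2 i hi)
    (fun x => Subtype.ext (e.symm_apply_apply _)) (fun x => Subtype.ext (e.apply_symm_apply _))

/-- Vectors supported in a subset of `A`, with respect to a basis and to its restriction. -/
def subRestrictEquiv (b : UnconditionalSchauderBasis ι 𝕜 Z) (A : Set ι) (B : Set A) :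
    sub (restrictBasis b A) B ≃L[𝕜] sub b (Subtype.val '' B) :=
  ContinuousLinearEquiv.equivOfInverse
    (((sub b A).subtypeL ∘L (sub (restrictBasis b A) B).subtypeL).codRestrict _ fun x i hi => by
      by_cases hA : i ∈ A
      · exact x.2 ⟨i, hA⟩ fun h => hi ⟨_, h, rfl⟩
      · exact x.1.2 i hA)
    (((sub b (Subtype.val '' B)).subtypeL.codRestrict (sub b A) fun x i hi =>
        x.2 i fun h => by obtain ⟨j, _, rfl⟩ := h; exact hi j.2).codRestrict _ fun x i hi =>
      x.2 i fun h => by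
        obtain ⟨j, hj, hji⟩ := h
        exact hi (Subtype.ext hji ▸ hj))
    (fun x => rfl) (fun x => rfl)

lemma SemiNormalized.map {b : UnconditionalSchauderBasis ι 𝕜 Z} (h : SemiNormalized b)
    (e : Z ≃L[𝕜] W) : SemiNormalized (mapBasis b e) := by
  obtain ⟨c, C, hc, hb⟩ := h
  refine ⟨c / (‖(e.symm : W →L[𝕜] Z)‖ + 1), ‖(e : Z →L[𝕜] W)‖ * C, by positivity, fun i => ⟨?_, ?_⟩⟩
  · rw [div_le_iff₀ (by positivity)]
    have h1 := (e.symm : W →L[𝕜] Z).le_opNorm (e (b i))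
    rw [ContinuousLinearEquiv.coe_coe, e.symm_apply_apply] at h1
    change c ≤ ‖e (b i)‖ * _
    nlinarith [(hb i).1, norm_nonneg (e (b i))]
  · exact ((e : Z →L[𝕜] W).le_opNorm _).trans
      (mul_le_mul_of_nonneg_left (hb i).2 (norm_nonneg _))

lemma SemiNormalized.restrict {b : UnconditionalSchauderBasis ι 𝕜 Z} (h : SemiNormalized b)
    (A : Set ι) : SemiNormalized (restrictBasis b A) := by
  obtain ⟨c, C, hc, hb⟩ := h
  exact ⟨c, C, hc, fun i => hb i⟩

end Transport

/-! ### Finite direct sums, by induction on the number of summands. -/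

section Splitting

variable {𝕜 : Type*} [RCLike 𝕜]

lemma isCompactOperator_pi {J : Type*} [Fintype J] {X : J → Type*}
    [∀ j, NormedAddCommGroup (X j)] [∀ j, NormedSpace 𝕜 (X j)] {W : Type*} [NormedAddCommGroup W]
    [NormedSpace 𝕜 W] (hc : ∀ j, ∀ T : X j →L[𝕜] W, IsCompactOperator T)
    (T : (∀ j, X j) →L[𝕜] W) : IsCompactOperator T := by
  classical
  have e : T = ∑ j, (T ∘L ContinuousLinearMap.single 𝕜 X j) ∘L ContinuousLinearMap.proj j := by
    refine ContinuousLinearMap.ext fun x => ?_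
    rw [sum_apply]
    conv_lhs => rw [← Finset.univ_sum_single x, map_sum]
    rfl
  have h : T ∈ compactOperator (RingHom.id 𝕜) (∀ j, X j) W := by
    rw [e]
    exact Submodule.sum_mem _ fun j _ =>
      (hc j (T ∘L ContinuousLinearMap.single 𝕜 X j)).comp_clm (ContinuousLinearMap.proj j)
  exact h

/-- Direct sums in which all operators from later to earlier summands are compact are splitting
for unconditional bases. -/
theorem splitting_of_isCompactOperator {n : ℕ} {X : Fin (n + 1) → Type*}
    [∀ j, NormedAddCommGroup (X j)] [∀ j, NormedSpace 𝕜 (X j)] [∀ j, CompleteSpace (X j)]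
    (hc : ∀ j k, j < k → ∀ T : X k →L[𝕜] X j, IsCompactOperator T) :
    SplittingForUnconditionalBases 𝕜 X := by
  classical
  induction n with
  | zero =>
    intro ι _ b
    refine ⟨fun _ => 0, fun j => ?_⟩
    rw [topologicalClosure_span_eq_sub]
    obtain rfl : j = 0 := Fin.fin_one_eq_zero j
    exact ⟨ContinuousLinearEquiv.equivOfInverse
      (ContinuousLinearMap.proj 0 ∘L (sub b _).subtypeL)
      ((ContinuousLinearMap.pi fun j => (by
          rw [Fin.fin_one_eq_zero j]; exact ContinuousLinearMap.id 𝕜 (X 0))).codRestrict _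
        fun x i hi => absurd rfl hi)
      (fun x => Subtype.ext (funext fun j => by rw [Fin.fin_one_eq_zero j]; rfl)) fun x => rfl⟩
  | succ n ih =>
    intro ι _ b
    let e := (Fin.consEquivL 𝕜 X).symm
    obtain ⟨A, ⟨e₀⟩, ⟨e₁⟩⟩ := exists_splitting_prod (mapBasis b e)
      (isCompactOperator_pi fun j => hc 0 j.succ (Fin.succ_pos j))
    obtain ⟨τ, hτ⟩ := ih (X := fun j => X j.succ)
      (fun j k hjk => hc j.succ k.succ (Fin.succ_lt_succ_iff.2 hjk)) (Aᶜ : Set ι) inferInstance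
      (mapBasis (restrictBasis (mapBasis b e) Aᶜ) e₁)
    refine ⟨fun i => if h : i ∈ A then 0 else (τ ⟨i, h⟩).succ, fun j => ?_⟩
    rw [topologicalClosure_span_eq_sub]
    refine Fin.cases ?_ (fun k => ?_) j
    · have : {i | (if h : i ∈ A then 0 else (τ ⟨i, h⟩).succ) = 0} = A := by
        ext i
        by_cases h : i ∈ A <;> simp [h, Fin.succ_ne_zero]
      rw [this]
      exact ⟨(subMapEquiv b e A).trans e₀⟩
    · have : {i | (if h : i ∈ A then 0 else (τ ⟨i, h⟩).succ) = k.succ}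
          = Subtype.val '' {i : (Aᶜ : Set ι) | τ i = k} := by
        ext i
        by_cases h : i ∈ A
        · simp [h, (Fin.succ_ne_zero k).symm]
        · simp [h]
      rw [this]
      obtain ⟨e₂⟩ := hτ k
      rw [topologicalClosure_span_eq_sub] at e₂
      exact ⟨(subMapEquiv b e _).trans ((subRestrictEquiv _ _ _).symm.trans
        ((subMapEquiv _ e₁ _).trans e₂))⟩

end Splitting

/-! ### Uniqueness of bases from splitting. -/

section UTAP

variable {𝕜 : Type*} [RCLike 𝕜] {J : Type*} [Fintype J] {X : J → Type*}
  [∀ j, NormedAddCommGroup (X j)] [∀ j, NormedSpace 𝕜 (X j)]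

lemma single_const_eq_same {κ M : Type*} [Zero M] (d : DecidableEq κ) (p : κ) (x : M) :
    (Pi.single p x : κ → M) p = x := by simp

lemma single_const_of_ne {κ M : Type*} [Zero M] (d : DecidableEq κ) {p q : κ} (h : p ≠ q) (x : M) :
    (Pi.single q x : κ → M) p = 0 := by simp [h]

open scoped Classical in
/-- The direct sum of bases. -/
def piBasis {ι : J → Type*} (b : ∀ j, UnconditionalSchauderBasis (ι j) 𝕜 (X j)) :
    UnconditionalSchauderBasis (Σ j, ι j) 𝕜 (∀ j, X j) where
  basis p := Pi.single p.1 (b p.1 p.2)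
  coord p := (b p.1).coord p.2 ∘L ContinuousLinearMap.proj p.1
  ortho p q := by
    obtain ⟨j, i⟩ := p
    obtain ⟨k, l⟩ := q
    change (b j).coord i (Pi.single (M := X) k (b k l) j) = _
    by_cases hjk : j = k
    · subst hjk
      rw [Pi.single_eq_same, (b j).ortho]
      by_cases hil : i = l
      · subst hil
        rw [Pi.single_eq_same]
        exact (single_const_eq_same _ _ _).symm
      · rw [Pi.single_eq_of_ne hil]
        exact (single_const_of_ne _ (by simpa using hil) _).symm
    · rw [Pi.single_eq_of_ne hjk, map_zero]
      exact (single_const_of_ne _ (fun h => hjk (congrArg Sigma.fst h)) _).symm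
  expansion x := by
    refine Pi.hasSum.2 fun k => ?_
    rw [← (sigma_mk_injective (i := k)).hasSum_iff]
    · have h := (b k).expansion (x k)
      have e : (fun p : Σ j, ι j => (((b p.1).coord p.2 ∘L ContinuousLinearMap.proj p.1) x •
          (Pi.single p.1 (b p.1 p.2) : ∀ j, X j)) k) ∘ Sigma.mk k
          = fun i => (b k).coord i (x k) • b k i := by
        funext i
        simp
      rw [e]
      exact h
    · rintro ⟨j, i⟩ h
      have hjk : k ≠ j := fun e => h ⟨e ▸ i, by subst e; rfl⟩
      simp [Pi.single_eq_of_ne hjk]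

/-- Isomorphisms of the summands with the parts of a partitioned basis can be glued. -/
def gluePartition {κ : Type*} [∀ j, CompleteSpace (X j)]
    (b : UnconditionalSchauderBasis κ 𝕜 (∀ j, X j)) (σ : κ → J)
    (V : ∀ j, X j ≃L[𝕜] sub b {i | σ i = j}) : (∀ j, X j) ≃L[𝕜] (∀ j, X j) :=
  ContinuousLinearEquiv.equivOfInverse
    (∑ j, (sub b {i | σ i = j}).subtypeL ∘L (V j : X j →L[𝕜] sub b {i | σ i = j}) ∘L
      ContinuousLinearMap.proj j)
    (ContinuousLinearMap.pi fun j => ((V j).symm : sub b {i | σ i = j} →L[𝕜] X j) ∘L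
      (mult b (ind 𝕜 {i | σ i = j})).codRestrict (sub b {i | σ i = j}) fun z i hi => by
        rw [coord_mult (norm_ind_le _), ind_of_notMem hi, zero_mul])
    (fun x => funext fun j => by
      change (V j).symm ⟨mult b (ind 𝕜 {i | σ i = j}) _, _⟩ = x j
      rw [ContinuousLinearEquiv.symm_apply_eq]
      refine Subtype.ext (ext_coord (b := b) fun i => ?_)
      rw [coord_mult (norm_ind_le _), sum_apply, map_sum]
      by_cases hi : σ i = j
      · rw [ind_of_mem (A := {i | σ i = j}) hi, one_mul,
          Finset.sum_eq_single_of_mem j (Finset.mem_univ j)]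
        · rfl
        · exact fun k _ hk => (V k (x k)).2 i fun h => hk (h.symm.trans hi)
      · rw [ind_of_notMem (A := {i | σ i = j}) hi, zero_mul, (V j (x j)).2 i hi])
    (fun z => by
      refine ext_coord (b := b) fun i => ?_
      rw [sum_apply, map_sum, Finset.sum_eq_single_of_mem (σ i) (Finset.mem_univ _)]
      · change b.coord i ((V (σ i) ((V (σ i)).symm ⟨mult b (ind 𝕜 {k | σ k = σ i}) z, _⟩) :
          sub b {k | σ k = σ i}) : ∀ j, X j) = _
        rw [ContinuousLinearEquiv.apply_symm_apply, coord_mult (norm_ind_le _),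
          ind_of_mem (A := {k | σ k = σ i}) rfl, one_mul]
      · intro k _ hk
        exact (V k _).2 i fun h => hk h.symm)

lemma gluePartition_single {κ : Type*} [DecidableEq J] [∀ j, CompleteSpace (X j)]
    (b : UnconditionalSchauderBasis κ 𝕜 (∀ j, X j)) (σ : κ → J)
    (V : ∀ j, X j ≃L[𝕜] sub b {i | σ i = j}) (j : J) (x : X j) :
    gluePartition b σ V (Pi.single j x) = V j x := by
  change (∑ k, (sub b {i | σ i = k}).subtypeL ∘L (V k : X k →L[𝕜] sub b {i | σ i = k}) ∘L
      ContinuousLinearMap.proj k) (Pi.single j x) = V j x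
  rw [sum_apply, Finset.sum_eq_single_of_mem j (Finset.mem_univ j)]
  · simp
  · intro k _ hk
    simp [Pi.single_eq_of_ne hk]

lemma SemiNormalized.pi {ι : J → Type*} {b : ∀ j, UnconditionalSchauderBasis (ι j) 𝕜 (X j)}
    (h : ∀ j, SemiNormalized (b j)) : SemiNormalized (piBasis b) := by
  classical
  choose c C hc hb using h
  obtain ⟨c₀, hc₀, hc₀'⟩ : ∃ c₀ : ℝ, 0 < c₀ ∧ ∀ j, c₀ ≤ c j := by
    rcases isEmpty_or_nonempty J with hJ | hJ
    · exact ⟨1, one_pos, fun j => hJ.elim j⟩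
    · obtain ⟨j, hj⟩ := Finite.exists_min c
      exact ⟨c j, hc j, hj⟩
  obtain ⟨C₀, hC₀⟩ := (Set.finite_range C).bddAbove
  refine ⟨c₀, C₀, hc₀, fun p => ?_⟩
  change c₀ ≤ ‖(Pi.single p.1 (b p.1 p.2) : ∀ j, X j)‖ ∧
    ‖(Pi.single p.1 (b p.1 p.2) : ∀ j, X j)‖ ≤ C₀
  rw [Pi.norm_single]
  exact ⟨(hc₀' _).trans (hb p.1 p.2).1, (hb p.1 p.2).2.trans (hC₀ (mem_range_self _))⟩

/-- The direct sum of spaces with unique unconditional bases has such a basis if it is splitting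
for unconditional bases. -/
theorem hasUTAPBasis_pi {J : Type} [Fintype J] {X : J → Type*}
    [∀ j, NormedAddCommGroup (X j)] [∀ j, NormedSpace 𝕜 (X j)] [∀ j, CompleteSpace (X j)] (hs : SplittingForUnconditionalBases 𝕜 X)
    (h : ∀ j, HasUTAPBasis 𝕜 (X j)) : HasUTAPBasis 𝕜 (∀ j, X j) := by
  classical
  choose ι hι b hb hb' using h
  refine ⟨Σ j, ι j, inferInstance, piBasis b, SemiNormalized.pi hb, fun κ _ b' hsn => ?_⟩
  obtain ⟨σ, hσ⟩ := hs κ inferInstance b'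
  have hσ' : ∀ j, Nonempty (sub b' {i | σ i = j} ≃L[𝕜] X j) := fun j => by
    rw [← topologicalClosure_span_eq_sub]; exact hσ j
  have e := fun j => (hσ' j).some
  -- Each part of `b'`, carried over to `X j`, is a semi-normalized basis there, so uniqueness in `X
  -- j` applies to it.
  have hp := fun j => hb' j {i | σ i = j} inferInstance (mapBasis (restrictBasis b' _) (e j))
    ((hsn.restrict _).map (e j))
  choose π T hT using hp
  refine ⟨(Equiv.sigmaCongrRight π).trans (Equiv.sigmaFiberEquiv σ),
    gluePartition b' σ fun j => (T j).trans (e j).symm, fun p => ?_⟩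
  change gluePartition b' σ _ (Pi.single p.1 (b p.1 p.2)) = _
  rw [gluePartition_single]
  change (((e p.1).symm (T p.1 (b p.1 p.2)) : sub b' _) : ∀ j, X j) = _
  rw [hT]
  change (((e p.1).symm (e p.1 (restrictBasis b' _ (π p.1 p.2))) : sub b' _) : ∀ j, X j) = _
  rw [ContinuousLinearEquiv.symm_apply_apply]
  rfl

end UTAP

/-! ### Finite `ℓ_q`-norms. -/

section SequenceNorms

/-- The `ℓ_q`-norm of a finite family of nonnegative numbers. -/
def lqNorm (q : ℝ≥0∞) {m : ℕ} (t : Fin m → ℝ) : ℝ :=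
  if q = ∞ then ⨆ k, t k else (∑ k, t k ^ q.toReal) ^ (1 / q.toReal)

lemma norm_toLp_eq {E : Type*} [NormedAddCommGroup E] {q : ℝ≥0∞} (hq : 0 < q) {m : ℕ}
    (f : Fin m → E) :
    ‖(WithLp.toLp q f : PiLp q fun _ : Fin m => E)‖ = lqNorm q fun k => ‖f k‖ := by
  unfold lqNorm
  split_ifs with h
  · subst h
    exact PiLp.norm_eq_ciSup _
  · exact PiLp.norm_eq_sum (ENNReal.toReal_pos hq.ne' h) _

variable {q r : ℝ≥0∞} {m : ℕ} {s t : Fin m → ℝ}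

lemma lqNorm_nonneg (ht : ∀ k, 0 ≤ t k) : 0 ≤ lqNorm q t := by
  unfold lqNorm
  split_ifs
  · exact Real.iSup_nonneg ht
  · exact Real.rpow_nonneg (Finset.sum_nonneg fun k _ => Real.rpow_nonneg (ht k) _) _

lemma lqNorm_mono (ht : ∀ k, 0 ≤ t k) (hts : ∀ k, t k ≤ s k) : lqNorm q t ≤ lqNorm q s := by
  unfold lqNorm
  split_ifs
  · exact ciSup_mono (Set.finite_range s).bddAbove hts
  · have h0 : ∀ k, 0 ≤ t k ^ q.toReal := fun k => Real.rpow_nonneg (ht k) _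
    exact Real.rpow_le_rpow (Finset.sum_nonneg fun k _ => h0 k)
      (Finset.sum_le_sum fun k _ => Real.rpow_le_rpow (ht k) (hts k) ENNReal.toReal_nonneg)
      (by positivity)

lemma lqNorm_const_mul (hq : 0 < q) {c : ℝ} (hc : 0 ≤ c) (ht : ∀ k, 0 ≤ t k) :
    lqNorm q (fun k => c * t k) = c * lqNorm q t := by
  unfold lqNorm
  split_ifs with h
  · exact (Real.mul_iSup_of_nonneg hc _).symm
  · have hp := ENNReal.toReal_pos hq.ne' h
    have : ∑ k, (c * t k) ^ q.toReal = c ^ q.toReal * ∑ k, t k ^ q.toReal := by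
      rw [Finset.mul_sum]
      exact Finset.sum_congr rfl fun k _ => Real.mul_rpow hc (ht k)
    rw [this, Real.mul_rpow (Real.rpow_nonneg hc _)
      (Finset.sum_nonneg fun k _ => Real.rpow_nonneg (ht k) _), ← Real.rpow_mul hc,
      mul_one_div_cancel hp.ne', Real.rpow_one]

lemma le_lqNorm (hq : 0 < q) (ht : ∀ k, 0 ≤ t k) (k : Fin m) : t k ≤ lqNorm q t := by
  unfold lqNorm
  split_ifs with h
  · exact le_ciSup (Set.finite_range t).bddAbove k
  · have hp := ENNReal.toReal_pos hq.ne' h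
    calc t k = (t k ^ q.toReal) ^ (1 / q.toReal) := by
          rw [← Real.rpow_mul (ht k), mul_one_div_cancel hp.ne', Real.rpow_one]
      _ ≤ _ := Real.rpow_le_rpow (Real.rpow_nonneg (ht k) _)
          (Finset.single_le_sum (f := fun k => t k ^ q.toReal)
            (fun k _ => Real.rpow_nonneg (ht k) _) (Finset.mem_univ k)) (by positivity)

/-- For `q = ∞` the conventions `∞.toReal = 0` and `1 / 0 = 0` turn the right side into 1, the
correct maximum, so one formula covers all exponents. -/
lemma lqNorm_one (q : ℝ≥0∞) {m : ℕ} (hm : 0 < m) :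
    lqNorm q (fun _ : Fin m => 1) = (m : ℝ) ^ (1 / q.toReal) := by
  have : Nonempty (Fin m) := ⟨⟨0, hm⟩⟩
  unfold lqNorm
  split_ifs with h
  · simp [h]
  · simp

/-- The norms of `ℓ_q` and `ℓ_r` are not comparable unless `q = r`. -/
lemma eq_of_lqNorm_le (hq : 0 < q) (hqr : q ≤ r) {c C : ℝ} (hc : 0 < c)
    (h : ∀ m : ℕ, c * lqNorm q (fun _ : Fin m => 1) ≤ C * lqNorm r (fun _ : Fin m => 1)) :
    q = r := by
  by_contra hne
  have hlt : q < r := lt_of_le_of_ne hqr hne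
  have hp := ENNReal.toReal_pos hq.ne' hlt.ne_top
  have hexp : 1 / r.toReal < 1 / q.toReal := by
    by_cases hr : r = ∞
    · subst hr; simpa using hp
    · exact one_div_lt_one_div_of_lt hp ((ENNReal.toReal_lt_toReal hlt.ne_top hr).2 hlt)
  have ht : Tendsto (fun m : ℕ => (m : ℝ) ^ (1 / q.toReal - 1 / r.toReal)) atTop atTop :=
    (tendsto_rpow_atTop (sub_pos.2 hexp)).comp tendsto_natCast_atTop_atTop
  obtain ⟨m, hm, hm1⟩ := ((ht.eventually_gt_atTop (C / c)).and (eventually_gt_atTop 0)).exists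
  have hm' : (0 : ℝ) < m := by exact_mod_cast hm1
  have h1 := h m
  rw [lqNorm_one q hm1, lqNorm_one r hm1] at h1
  rw [Real.rpow_sub hm', div_lt_div_iff₀ hc (Real.rpow_pos_of_pos hm' _)] at hm
  linarith

end SequenceNorms

/-! ### Copies of `ℓ_q` and `c₀` from basic estimates. -/

section Embedding

variable {𝕜 : Type*} [RCLike 𝕜] {X : Type*} [NormedAddCommGroup X] [NormedSpace 𝕜 X]
  [CompleteSpace X]

/-- A sequence equivalent to the unit vector basis of `ℓ_q` spans a copy of `ℓ_q`
(of `c₀` if `q = ∞`). -/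
lemma containsLq_of_sequence {q : ℝ≥0∞} (hq : 0 < q) {f : ℕ → X} {c C : ℝ} (hc : 0 < c)
    (hlow : ∀ (m : ℕ) (a : ℕ → 𝕜), c * lqNorm q (fun k : Fin m => ‖a k‖)
      ≤ ‖∑ k ∈ Finset.range m, a k • f k‖)
    (hup : ∀ (m : ℕ) (a : ℕ → 𝕜), ‖∑ k ∈ Finset.range m, a k • f k‖
      ≤ C * lqNorm q (fun k : Fin m => ‖a k‖)) : ContainsLq 𝕜 X q := by
  classical
  wlog hC : 0 ≤ C generalizing C
  · refine this (C := |C|) (fun m a => (hup m a).trans ?_) (abs_nonneg C)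
    exact mul_le_mul_of_nonneg_right (le_abs_self C) (lqNorm_nonneg fun k => norm_nonneg _)
  -- Padding with zero coefficients turns any finite sum into one over an initial segment, so `hup`
  -- yields the Cauchy criterion for unconditional summability.
  have hset : ∀ (s : Finset ℕ) (a : ℕ → 𝕜), ∃ m, (∑ k ∈ s, a k • f k
      = ∑ k ∈ Finset.range m, (if k ∈ s then a k else 0) • f k) ∧ s ⊆ Finset.range m := by
    intro s a
    obtain ⟨m, hm⟩ := s.exists_nat_subset_range
    refine ⟨m, ?_, hm⟩
    simp only [ite_smul, zero_smul]
    rw [Finset.sum_ite_mem, Finset.inter_eq_right.2 hm]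
  by_cases htop : q = ∞
  · subst htop
    refine Or.inr ⟨rfl, ?_⟩
    have hsum : ∀ a : ZeroAtInftyContinuousMap ℕ 𝕜, Summable fun k => a k • f k := by
      intro a
      rw [summable_iff_vanishing_norm]
      intro ε hε
      have ha : Tendsto (fun k => ‖a k‖) atTop (𝓝 0) := by
        have := a.zero_at_infty'
        rw [Filter.cocompact_eq_cofinite, Nat.cofinite_eq_atTop] at this
        simpa using this.norm
      obtain ⟨N, hN⟩ := eventually_atTop.1
        (ha.eventually_lt_const (show 0 < ε / (C + 1) by positivity))
      refine ⟨Finset.range N, fun t ht => ?_⟩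
      obtain ⟨m, hm, -⟩ := hset t a
      rw [hm]
      refine (hup m _).trans_lt ?_
      have : lqNorm ∞ (fun k : Fin m => ‖(if (k : ℕ) ∈ t then a k else 0 : 𝕜)‖) ≤ ε / (C + 1) := by
        rw [lqNorm, if_pos rfl]
        refine Real.iSup_le (fun k => ?_) (by positivity)
        split_ifs with hk
        · refine (hN k ?_).le
          by_contra hlt
          exact Finset.disjoint_left.1 ht hk (Finset.mem_range.2 (not_le.1 hlt))
        · simp; positivity
      refine (mul_le_mul_of_nonneg_left this hC).trans_lt ?_
      rw [← mul_div_assoc, div_lt_iff₀ (by positivity)]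
      nlinarith
    refine ⟨{ toFun := fun a => ∑' k, a k • f k
              map_add' := fun a a' => by
                rw [← (hsum a).tsum_add (hsum a')]; simp [add_smul]
              map_smul' := fun x a => by
                rw [RingHom.id_apply, ← (hsum a).tsum_const_smul]; simp [mul_smul] },
      c, C, hc, fun a => ?_⟩
    have hlim := ((hsum a).hasSum.tendsto_sum_nat).norm
    have hle : ∀ k, ‖a k‖ ≤ ‖a‖ := fun k => by
      rw [← ZeroAtInftyContinuousMap.norm_toBCF_eq_norm]
      exact a.toBCF.norm_coe_le_norm k
    constructor
    · change c * ‖a‖ ≤ ‖∑' k, a k • f k‖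
      rw [← le_div_iff₀' hc, ← ZeroAtInftyContinuousMap.norm_toBCF_eq_norm,
        BoundedContinuousFunction.norm_le (by positivity)]
      intro k
      rw [le_div_iff₀' hc]
      refine ge_of_tendsto hlim (eventually_atTop.2 ⟨k + 1, fun m hm => ?_⟩)
      refine le_trans ?_ (hlow m a)
      exact mul_le_mul_of_nonneg_left
        (le_lqNorm hq (t := fun k : Fin m => ‖a k‖) (fun _ => norm_nonneg _) ⟨k, hm⟩) hc.le
    · refine le_of_tendsto hlim (Eventually.of_forall fun m => (hup m a).trans ?_)
      refine mul_le_mul_of_nonneg_left ?_ hC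
      rw [lqNorm, if_pos rfl]
      exact Real.iSup_le (fun k => hle k) (norm_nonneg _)
  · refine Or.inl ⟨htop, ?_⟩
    have hp := ENNReal.toReal_pos hq.ne' htop
    set p := q.toReal with hpdef
    have hlq : ∀ (m : ℕ) (a : ℕ → 𝕜), lqNorm q (fun k : Fin m => ‖a k‖)
        = (∑ k ∈ Finset.range m, ‖a k‖ ^ p) ^ (1 / p) := fun m a => by
      rw [lqNorm, if_neg htop, Finset.sum_range fun k => ‖a k‖ ^ p]
    have hsp : ∀ a : lp (fun _ : ℕ => 𝕜) q, Summable fun k => ‖a k‖ ^ p := fun a =>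
      (lp.memℓp a).summable hp
    have hsum : ∀ a : lp (fun _ : ℕ => 𝕜) q, Summable fun k => a k • f k := by
      intro a
      rw [summable_iff_vanishing_norm]
      intro ε hε
      obtain ⟨s, hs⟩ := summable_iff_vanishing_norm.1 (hsp a) ((ε / (C + 1)) ^ p) (by positivity)
      refine ⟨s, fun t ht => ?_⟩
      obtain ⟨m, hm, htm⟩ := hset t a
      rw [hm]
      refine (hup m _).trans_lt ?_
      have h0 : 0 ≤ ∑ k ∈ t, ‖a k‖ ^ p := Finset.sum_nonneg fun k _ => by positivity
      have e : ∑ k ∈ Finset.range m, ‖(if k ∈ t then a k else 0 : 𝕜)‖ ^ p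
          = ∑ k ∈ t, ‖a k‖ ^ p := by
        rw [← Finset.sum_subset htm]
        · exact Finset.sum_congr rfl fun k hk => by rw [if_pos hk]
        · intro k _ hk
          rw [if_neg hk, norm_zero, Real.zero_rpow hp.ne']
      have h1 := hs t ht
      rw [Real.norm_of_nonneg h0] at h1
      rw [hlq m fun k => if k ∈ t then a k else 0, e]
      have h2 : (∑ k ∈ t, ‖a k‖ ^ p) ^ (1 / p) ≤ ε / (C + 1) := by
        refine (Real.rpow_le_rpow h0 h1.le (by positivity)).trans_eq ?_
        rw [← Real.rpow_mul (by positivity), mul_one_div_cancel hp.ne', Real.rpow_one]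
      refine (mul_le_mul_of_nonneg_left h2 hC).trans_lt ?_
      rw [← mul_div_assoc, div_lt_iff₀ (by positivity)]
      nlinarith
    refine ⟨{ toFun := fun a => ∑' k, a k • f k
              map_add' := fun a a' => by
                rw [← (hsum a).tsum_add (hsum a')]; simp [add_smul]
              map_smul' := fun x a => by
                rw [RingHom.id_apply, ← (hsum a).tsum_const_smul]; simp [mul_smul] },
      c, C, hc, fun a => ?_⟩
    have hlim := ((hsum a).hasSum.tendsto_sum_nat).norm
    have hlim' : Tendsto (fun m => lqNorm q (fun k : Fin m => ‖a k‖)) atTop (𝓝 ‖a‖) := by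
      rw [lp.norm_eq_tsum_rpow hp]
      simp only [hlq]
      exact ((hsp a).hasSum.tendsto_sum_nat).rpow_const (Or.inr (by positivity))
    exact ⟨le_of_tendsto_of_tendsto' (hlim'.const_mul c) hlim fun m => hlow m a,
      le_of_tendsto_of_tendsto' hlim (hlim'.const_mul C) fun m => hup m a⟩

end Embedding

/-! ### Noncompact operators and disjoint sequences. -/

section Pitt

variable {𝕜 : Type*} [RCLike 𝕜] {X : Type*} [NormedAddCommGroup X] [NormedSpace 𝕜 X]
  {Y : Type*} [NormedAddCommGroup Y] [NormedSpace 𝕜 Y] {ι κ : Type*}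

lemma exists_separated_of_not_isCompactOperator [CompleteSpace X] {T : Y →L[𝕜] X}
    (hT : ¬ IsCompactOperator T) :
    ∃ δ > 0, ∃ y : ℕ → Y, (∀ n, ‖y n‖ ≤ 1) ∧ ∀ m n, m < n → δ ≤ ‖T (y n) - T (y m)‖ := by
  have hnot : ¬ TotallyBounded (T '' Metric.closedBall 0 1) := fun h => hT <|
    (isCompactOperator_iff_isCompact_closure_image_closedBall (T : Y →ₗ[𝕜] X) one_pos).2
      (h.closure.isCompact_of_isClosed isClosed_closure)
  rw [Metric.totallyBounded_iff] at hnot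
  push Not at hnot
  obtain ⟨δ, hδ, h⟩ := hnot
  obtain ⟨y, hy, hsep⟩ := exists_seq_of_forall_finset_exists (fun y : Y => ‖y‖ ≤ 1)
    (fun x y => δ ≤ ‖T y - T x‖) fun s _ => by
      have h1 := h (T '' s) (s.finite_toSet.image _)
      obtain ⟨_, ⟨y, hy, rfl⟩, hyn⟩ := not_subset.1 h1
      refine ⟨y, by simpa using hy, fun x hx => ?_⟩
      by_contra hlt
      refine hyn (mem_iUnion₂.2 ⟨T x, mem_image_of_mem _ hx, ?_⟩)
      rw [Metric.mem_ball, dist_eq_norm]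
      exact not_le.1 hlt
  exact ⟨δ, hδ, y, hy, hsep⟩

/-- A noncompact operator does not shrink some bounded sequence on which countably many given
functionals tend to zero. -/
lemma exists_null_sequence [CompleteSpace X] [Countable κ] {T : Y →L[𝕜] X}
    (hT : ¬ IsCompactOperator T) (ψ : κ → StrongDual 𝕜 Y) :
    ∃ δ > 0, ∃ d : ℕ → Y, (∀ n, ‖d n‖ ≤ 2) ∧ (∀ n, δ ≤ ‖T (d n)‖) ∧
      ∀ i, Tendsto (fun n => ψ i (d n)) atTop (𝓝 0) := by
  obtain ⟨δ, hδ, y, hy, hsep⟩ := exists_separated_of_not_isCompactOperator hT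
  -- A diagonal subsequence makes all functionals converge along `y`. Differences of consecutive
  -- terms then tend to zero under each functional, while separation keeps their images large.
  have hK : IsCompact (univ.pi fun i => Metric.closedBall (0 : 𝕜) ‖ψ i‖) :=
    isCompact_univ_pi fun i => isCompact_closedBall _ _
  obtain ⟨a, -, φ, hφ, hlim⟩ := hK.tendsto_subseq (x := fun n i => ψ i (y n)) fun n i _ => by
    rw [mem_closedBall_zero_iff]
    exact ((ψ i).le_opNorm _).trans (mul_le_of_le_one_right (norm_nonneg _) (hy n))
  refine ⟨δ, hδ, fun n => y (φ (n + 1)) - y (φ n), fun n => ?_, fun n => ?_, fun i => ?_⟩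
  · refine (norm_sub_le _ _).trans ?_
    linarith [hy (φ (n + 1)), hy (φ n)]
  · rw [map_sub]; exact hsep _ _ (hφ (Nat.lt_succ_self n))
  · have h1 := (tendsto_pi_nhds.1 hlim i)
    have h2 := (h1.comp (tendsto_add_atTop_nat 1)).sub h1
    rw [sub_self] at h2
    simpa [Function.comp_def] using h2

/-- The part of `d n` on the fixed finite set `F` tends to zero, so it can be cut out of a good
finite truncation at little cost. -/
lemma eventually_exists_disjoint_proj (b : UnconditionalSchauderBasis ι 𝕜 Y) {d : ℕ → Y}
    (hd : ∀ i, Tendsto (fun n => b.coord i (d n)) atTop (𝓝 0)) (F : Finset ι) {η : ℝ}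
    (hη : 0 < η) :
    ∀ᶠ n in atTop, ∃ F' : Finset ι, Disjoint F F' ∧ ‖d n - b.proj F' (d n)‖ ≤ η := by
  classical
  have h : Tendsto (fun n => ‖b.proj F (d n)‖) atTop (𝓝 0) := by
    have : Tendsto (fun n => ∑ i ∈ F, b.coord i (d n) • b i) atTop (𝓝 (∑ i ∈ F, (0 : 𝕜) • b i)) :=
      tendsto_finsetSum _ fun i _ => (hd i).smul_const _
    simpa using this.norm
  filter_upwards [h.eventually_lt_const (half_pos hη)] with n hn
  obtain ⟨s, hs⟩ := exists_norm_sub_proj_le (b := b) (d n) (half_pos hη)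
  refine ⟨(s ∪ F) \ F, Finset.disjoint_sdiff, ?_⟩
  have e : d n - b.proj ((s ∪ F) \ F) (d n) = (d n - b.proj (s ∪ F) (d n)) + b.proj F (d n) := by
    have : b.proj ((s ∪ F) \ F) (d n) + b.proj F (d n) = b.proj (s ∪ F) (d n) := by
      simp only [b.proj_apply]
      exact Finset.sum_sdiff Finset.subset_union_right
    rw [← this]; abel
  rw [e]
  refine (norm_add_le _ _).trans ?_
  linarith [hs (s ∪ F) Finset.subset_union_left]

lemma supp_proj_subset (b : UnconditionalSchauderBasis ι 𝕜 Y) (F : Finset ι) (y : Y) :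
    supp b (b.proj F y) ⊆ F := fun i hi => by
  classical
  by_contra h
  exact hi (by rw [coord_proj, if_neg (by simpa using h)])

/-- The gliding hump: a noncompact operator almost maps some sequence of disjointly supported
vectors to a sequence of such vectors. -/
lemma exists_disjoint_sequences [CompleteSpace X] [Countable ι] [Countable κ]
    (bX : UnconditionalSchauderBasis ι 𝕜 X) (bY : UnconditionalSchauderBasis κ 𝕜 Y)
    {T : Y →L[𝕜] X} (hT : ¬ IsCompactOperator T) :
    ∃ δ > 0, ∀ η > 0, ∃ (f : ℕ → Y) (g : ℕ → X),
      (∀ m n, m ≠ n → Disjoint (supp bY (f m)) (supp bY (f n))) ∧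
      (∀ m n, m ≠ n → Disjoint (supp bX (g m)) (supp bX (g n))) ∧
      (∀ n, ‖f n‖ ≤ 2 + η) ∧ (∀ n, δ - η ≤ ‖g n‖) ∧
      ∀ n, ‖T (f n) - g n‖ ≤ (‖T‖ + 1) * η * (1 / 2) ^ n := by
  classical
  obtain ⟨δ, hδ, d, hd, hTd, hnull⟩ := exists_null_sequence hT
    (Sum.elim (fun i => bX.coord i ∘L T) bY.coord)
  refine ⟨δ, hδ, fun η hη => ?_⟩
  have hpow : ∀ N : ℕ, 0 < η * (1 / 2) ^ N := fun N => by positivity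
  have hpow1 : ∀ N : ℕ, η * (1 / 2 : ℝ) ^ N ≤ η := fun N =>
    mul_le_of_le_one_right hη.le (pow_le_one₀ (by norm_num) (by norm_num))
  -- A state consists of a stage number controlling the error, an index into `d`, and the finite
  -- supports kept in `Y` and in `X`. Stages strictly increase, so the `n`-th error is at most `η *
  -- (1 / 2) ^ n`.
  obtain ⟨a, ha, hr⟩ := exists_seq_of_forall_finset_exists
    (α := ℕ × ℕ × Finset κ × Finset ι)
    (fun p => ‖d p.2.1 - bY.proj p.2.2.1 (d p.2.1)‖ ≤ η * (1 / 2) ^ p.1 ∧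
      ‖T (d p.2.1) - bX.proj p.2.2.2 (T (d p.2.1))‖ ≤ η * (1 / 2) ^ p.1)
    (fun p p' => p.1 < p'.1 ∧ Disjoint p.2.2.1 p'.2.2.1 ∧ Disjoint p.2.2.2 p'.2.2.2)
    fun s _ => by
      set N := s.sup (fun p => p.1) + 1
      obtain ⟨n, ⟨F, hF, hF'⟩, ⟨G, hG, hG'⟩⟩ := ((eventually_exists_disjoint_proj bY
        (fun i => hnull (Sum.inr i)) (s.biUnion fun p => p.2.2.1) (hpow N)).and
        (eventually_exists_disjoint_proj bX (d := fun n => T (d n))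
        (fun i => hnull (Sum.inl i)) (s.biUnion fun p => p.2.2.2) (hpow N))).exists
      refine ⟨(N, n, F, G), ⟨hF', hG'⟩, fun p hp => ⟨?_, ?_, ?_⟩⟩
      · exact Nat.lt_succ_of_le (Finset.le_sup (f := fun p => p.1) hp)
      · exact hF.mono_left (Finset.subset_biUnion_of_mem (fun p => p.2.2.1) hp)
      · exact hG.mono_left (Finset.subset_biUnion_of_mem (fun p => p.2.2.2) hp)
  have hmono : ∀ n, n ≤ (a n).1 := fun n =>
    StrictMono.le_apply (f := fun n => (a n).1) (fun m n h => (hr m n h).1)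
  have hdisj : ∀ {P : ℕ → ℕ → Prop}, (∀ m n, P m n → P n m) → (∀ m n, m < n → P m n) →
      ∀ m n, m ≠ n → P m n := fun hsymm h m n hmn =>
    (lt_or_gt_of_ne hmn).elim (h m n) fun h' => hsymm _ _ (h n m h')
  refine ⟨fun n => bY.proj (a n).2.2.1 (d (a n).2.1),
    fun n => bX.proj (a n).2.2.2 (T (d (a n).2.1)), ?_, ?_, fun n => ?_, fun n => ?_, fun n => ?_⟩
  · refine hdisj (fun m n h => h.symm) fun m n h => ?_
    exact (Finset.disjoint_coe.2 (hr m n h).2.1).mono (supp_proj_subset _ _ _)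
      (supp_proj_subset _ _ _)
  · refine hdisj (fun m n h => h.symm) fun m n h => ?_
    exact (Finset.disjoint_coe.2 (hr m n h).2.2).mono (supp_proj_subset _ _ _)
      (supp_proj_subset _ _ _)
  · have h1 := norm_le_norm_add_norm_sub' (bY.proj (a n).2.2.1 (d (a n).2.1)) (d (a n).2.1)
    have h2 := (ha n).1
    rw [norm_sub_rev] at h2
    linarith [hd (a n).2.1, hpow1 (a n).1]
  · have h1 := norm_le_norm_add_norm_sub' (T (d (a n).2.1))
      (bX.proj (a n).2.2.2 (T (d (a n).2.1)))
    linarith [(ha n).2, hTd (a n).2.1, hpow1 (a n).1]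
  · have h1 := (ha n).1
    have h2 := (ha n).2
    set u := d (a n).2.1
    have e : T (bY.proj (a n).2.2.1 u) - bX.proj (a n).2.2.2 (T u)
        = (T u - bX.proj (a n).2.2.2 (T u)) - T (u - bY.proj (a n).2.2.1 u) := by
      rw [map_sub]; abel
    have hle : η * (1 / 2 : ℝ) ^ (a n).1 ≤ η * (1 / 2) ^ n :=
      mul_le_mul_of_nonneg_left (pow_le_pow_of_le_one (by norm_num) (by norm_num) (hmono n)) hη.le
    change ‖T (bY.proj (a n).2.2.1 u) - bX.proj (a n).2.2.2 (T u)‖ ≤ _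
    rw [e]
    refine (norm_sub_le _ _).trans ?_
    have h3 := T.le_opNorm (u - bY.proj (a n).2.2.1 u)
    have h4 := mul_le_mul_of_nonneg_left (h1.trans hle) (norm_nonneg T)
    linarith

lemma supp_smul_subset (b : UnconditionalSchauderBasis ι 𝕜 X) (a : 𝕜) (x : X) :
    supp b (a • x) ⊆ supp b x := fun i hi h => hi (by
  have h' : b.coord i x = 0 := h
  rw [map_smul, h', smul_zero])

/-- The estimate in the form used for a single disjoint sequence; the constant is made positive so
that it can be divided by. -/
lemma LowerEstimate.exists_le {b : UnconditionalSchauderBasis ι 𝕜 X} {q : ℝ≥0∞} (hq : 0 < q)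
    (h : LowerEstimate b q) : ∃ C > 0, ∀ (g : ℕ → X) (δ : ℝ), 0 ≤ δ →
      (∀ m n, m ≠ n → Disjoint (supp b (g m)) (supp b (g n))) → (∀ n, δ ≤ ‖g n‖) →
      ∀ (m : ℕ) (a : ℕ → 𝕜), δ * lqNorm q (fun k : Fin m => ‖a k‖)
        ≤ C * ‖∑ k ∈ Finset.range m, a k • g k‖ := by
  obtain ⟨C, hC⟩ := h
  refine ⟨|C| + 1, by positivity, fun g δ hδ hg hgδ m a => ?_⟩
  have h1 := hC m (fun k => a k • g k) fun k l hkl =>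
    (hg k l fun e => hkl (Fin.ext e)).mono (supp_smul_subset _ _ _) (supp_smul_subset _ _ _)
  rw [norm_toLp_eq hq] at h1
  rw [Finset.sum_range fun k => a k • g k, ← lqNorm_const_mul hq hδ fun k => norm_nonneg _]
  refine (lqNorm_mono (fun k => by positivity) fun k => ?_).trans (h1.trans ?_)
  · rw [norm_smul, mul_comm]
    exact mul_le_mul_of_nonneg_left (hgδ k) (norm_nonneg _)
  · exact mul_le_mul_of_nonneg_right (by linarith [le_abs_self C]) (norm_nonneg _)

lemma UpperEstimate.exists_le {b : UnconditionalSchauderBasis ι 𝕜 X} {q : ℝ≥0∞} (hq : 0 < q)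
    (h : UpperEstimate b q) : ∃ C > 0, ∀ (f : ℕ → X) (D : ℝ), 0 ≤ D →
      (∀ m n, m ≠ n → Disjoint (supp b (f m)) (supp b (f n))) → (∀ n, ‖f n‖ ≤ D) →
      ∀ (m : ℕ) (a : ℕ → 𝕜), ‖∑ k ∈ Finset.range m, a k • f k‖
        ≤ C * D * lqNorm q (fun k : Fin m => ‖a k‖) := by
  obtain ⟨C, hC⟩ := h
  refine ⟨|C| + 1, by positivity, fun f D hD hf hfD m a => ?_⟩
  have h1 := hC m (fun k => a k • f k) fun k l hkl =>
    (hf k l fun e => hkl (Fin.ext e)).mono (supp_smul_subset _ _ _) (supp_smul_subset _ _ _)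
  rw [norm_toLp_eq hq] at h1
  rw [Finset.sum_range fun k => a k • f k, mul_assoc, ← lqNorm_const_mul hq hD fun k => norm_nonneg _]
  have hle : lqNorm q (fun k : Fin m => ‖a k • f k‖) ≤ lqNorm q (fun k : Fin m => D * ‖a k‖) :=
    lqNorm_mono (fun k => norm_nonneg _) fun k => by
      rw [norm_smul, mul_comm]
      exact mul_le_mul_of_nonneg_right (hfD k) (norm_nonneg _)
  have h0 : 0 ≤ lqNorm q (fun k : Fin m => ‖a k • f k‖) := lqNorm_nonneg fun k => norm_nonneg _
  refine h1.trans ((mul_le_mul_of_nonneg_right ?_ h0).trans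
    (mul_le_mul_of_nonneg_left hle (by positivity)))
  linarith [le_abs_self C]

/-- A version of Pitt's theorem: a noncompact operator from a space with an upper `r`-estimate to
a space with a lower `q`-estimate provides a sequence which is dominated by the unit vector basis
of `ℓ_r`, and whose image dominates that of `ℓ_q`. -/
lemma exists_sequence_of_not_isCompactOperator [CompleteSpace X] [Countable ι] [Countable κ]
    {bX : UnconditionalSchauderBasis ι 𝕜 X} {bY : UnconditionalSchauderBasis κ 𝕜 Y}
    {q r : ℝ≥0∞} (hq : 0 < q) (hr : 0 < r) (hX : LowerEstimate bX q) (hY : UpperEstimate bY r)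
    {T : Y →L[𝕜] X} (hT : ¬ IsCompactOperator T) :
    ∃ (f : ℕ → Y) (c C : ℝ), 0 < c ∧ ∀ (m : ℕ) (a : ℕ → 𝕜),
      c * lqNorm q (fun k : Fin m => ‖a k‖) ≤ ‖∑ k ∈ Finset.range m, a k • T (f k)‖ ∧
      ‖∑ k ∈ Finset.range m, a k • f k‖ ≤ C * lqNorm r (fun k : Fin m => ‖a k‖) := by
  obtain ⟨δ, hδ, hseq⟩ := exists_disjoint_sequences bX bY hT
  obtain ⟨C₁, hC₁, hlow⟩ := hX.exists_le hq
  obtain ⟨C₂, hC₂, hup⟩ := hY.exists_le hr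
  -- The first bound keeps `‖g n‖ ≥ δ / 2`. By the second, replacing `g` by `T f` costs at most half
  -- of the lower bound, which leaves `δ / (4 * C₁)`.
  set η := min (δ / 2) (δ / (8 * C₁ * (‖T‖ + 1))) with hη
  have hη0 : 0 < η := by positivity
  have hη1 : η ≤ δ / 2 := min_le_left _ _
  have hη2 : η * (8 * C₁ * (‖T‖ + 1)) ≤ δ := by
    rw [← le_div_iff₀ (by positivity)]; exact min_le_right _ _
  obtain ⟨f, g, hf, hg, hf2, hgδ, hTfg⟩ := hseq η hη0
  refine ⟨f, δ / (4 * C₁), C₂ * (2 + η), by positivity, fun m a => ⟨?_, ?_⟩⟩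
  · set S := lqNorm q (fun k : Fin m => ‖a k‖) with hS
    have hS0 : 0 ≤ S := lqNorm_nonneg fun k => norm_nonneg _
    have h1 := hlow g (δ / 2) (by positivity) hg (fun n => by linarith [hgδ n]) m a
    have h2 : ‖∑ k ∈ Finset.range m, a k • g k‖ ≤ ‖∑ k ∈ Finset.range m, a k • T (f k)‖
        + S * ((‖T‖ + 1) * η) * 2 := by
      have e : ∑ k ∈ Finset.range m, a k • g k = ∑ k ∈ Finset.range m, a k • T (f k)
          - ∑ k ∈ Finset.range m, a k • (T (f k) - g k) := by
        rw [← Finset.sum_sub_distrib]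
        exact Finset.sum_congr rfl fun k _ => by rw [smul_sub]; abel
      rw [e]
      refine (norm_sub_le _ _).trans (add_le_add_right ?_ _)
      calc ‖∑ k ∈ Finset.range m, a k • (T (f k) - g k)‖
          ≤ ∑ k ∈ Finset.range m, S * ((‖T‖ + 1) * η) * (1 / 2) ^ k := by
            refine norm_sum_le_of_le _ fun k hk => ?_
            rw [norm_smul, mul_assoc]
            exact mul_le_mul (le_lqNorm hq (t := fun k : Fin m => ‖a k‖)
              (fun _ => norm_nonneg _) ⟨k, Finset.mem_range.1 hk⟩) (hTfg k) (norm_nonneg _) hS0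
        _ = S * ((‖T‖ + 1) * η) * ∑ k ∈ Finset.range m, (1 / 2 : ℝ) ^ k := by
            rw [Finset.mul_sum]
        _ ≤ S * ((‖T‖ + 1) * η) * 2 := by
            refine mul_le_mul_of_nonneg_left ?_ (by positivity)
            exact sum_geometric_two_le m
    rw [div_mul_eq_mul_div, div_le_iff₀ (by positivity)]
    have h3 := mul_le_mul_of_nonneg_left h2 hC₁.le
    have h4 := mul_le_mul_of_nonneg_left hη2 hS0
    nlinarith
  · exact hup f (2 + η) (by positivity) hf hf2 m a

end Pitt

/-! ### Compactness from lattice-estimate disjointness. -/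

section Disjointness

variable {𝕜 : Type*} [RCLike 𝕜]

/-- Infinite dimension provides infinitely many basis vectors; once normalized they are disjointly
supported, and the two estimates make them equivalent to the unit vectors of `ℓ_q`. -/
lemma containsLq_of_estimates {X : Type*} [NormedAddCommGroup X] [NormedSpace 𝕜 X]
    [CompleteSpace X] {ι : Type*} {b : UnconditionalSchauderBasis ι 𝕜 X} {q : ℝ≥0∞} (hq : 0 < q)
    (hX : ¬ FiniteDimensional 𝕜 X) (hlow : LowerEstimate b q) (hup : UpperEstimate b q) :
    ContainsLq 𝕜 X q := by
  have hinf : Infinite ι := by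
    by_contra hfin
    have : Finite ι := not_infinite_iff_finite.1 hfin
    have : Fintype ι := Fintype.ofFinite ι
    refine hX (.of_injective (LinearMap.pi fun i => (b.coord i).toLinearMap) ?_)
    exact fun x y h => ext_coord (b := b) fun i => congrFun h i
  let e := Infinite.natEmbedding ι
  have hne : ∀ i, b i ≠ 0 := fun i h => by
    have := coord_self (b := b) i
    rw [h, map_zero] at this
    exact zero_ne_one this
  let f : ℕ → X := fun n => (‖b (e n)‖⁻¹ : 𝕜) • b (e n)
  have hf : ∀ n, ‖f n‖ = 1 := fun n => norm_smul_inv_norm (hne _)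
  have hsupp : ∀ n, supp b (f n) ⊆ {e n} := fun n =>
    (supp_smul_subset b _ _).trans fun i hi => by
      by_contra h
      exact hi (coord_of_ne h)
  have hdisj : ∀ m n, m ≠ n → Disjoint (supp b (f m)) (supp b (f n)) := fun m n hmn =>
    (disjoint_singleton.2 (e.injective.ne hmn)).mono (hsupp m) (hsupp n)
  obtain ⟨C₁, hC₁, h₁⟩ := hlow.exists_le hq
  obtain ⟨C₂, -, h₂⟩ := hup.exists_le hq
  refine containsLq_of_sequence (f := f) (c := 1 / C₁) (C := C₂ * 1) hq (by positivity)
    (fun m a => ?_) (h₂ f 1 zero_le_one hdisj fun n => (hf n).le)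
  rw [div_mul_eq_mul_div, div_le_iff₀ hC₁, mul_comm _ C₁]
  exact h₁ f 1 zero_le_one hdisj (fun n => (hf n).ge) m a

/-- For lattice-estimate disjoint bases, all operators from later to earlier spaces
are compact. -/
lemma isCompactOperator_of_latticeEstimateDisjoint {n : ℕ} {X : Fin (n + 1) → Type*}
    [∀ j, NormedAddCommGroup (X j)] [∀ j, NormedSpace 𝕜 (X j)] [∀ j, CompleteSpace (X j)]
    {ι : Fin (n + 1) → Type*} [∀ j, Countable (ι j)]
    (hX : ∀ j, j ≠ 0 → j ≠ Fin.last n → ¬ FiniteDimensional 𝕜 (X j))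
    {B : ∀ j, UnconditionalSchauderBasis (ι j) 𝕜 (X j)} (hB : LatticeEstimateDisjoint B)
    (j k : Fin (n + 1)) (hjk : j < k) (T : X k →L[𝕜] X j) : IsCompactOperator T := by
  obtain ⟨q, hq, hmono, hest⟩ := hB
  obtain ⟨j, rfl⟩ := Fin.exists_castSucc_eq.2 (Fin.ne_last_of_lt hjk)
  -- From here on the source is `X k.succ`, whose upper estimate has exponent `q k`; adjacent
  -- summands correspond to `j = k`.
  obtain ⟨k, rfl⟩ := Fin.exists_succ_eq.2 (Fin.ne_zero_of_lt hjk)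
  have hjk' : j ≤ k := Fin.castSucc_lt_succ_iff.1 hjk
  by_contra hT
  obtain ⟨f, c, C, hc, hf⟩ := exists_sequence_of_not_isCompactOperator (hq j) (hq k)
    (hest j).1 (hest k).2.1 hT
  have hTsum : ∀ (m : ℕ) (a : ℕ → 𝕜), ‖∑ i ∈ Finset.range m, a i • T (f i)‖
      ≤ ‖T‖ * ‖∑ i ∈ Finset.range m, a i • f i‖ := fun m a => by
    have : ∑ i ∈ Finset.range m, a i • T (f i) = T (∑ i ∈ Finset.range m, a i • f i) := by
      simp [map_sum]
    rw [this]; exact T.le_opNorm _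
  have hqeq : q j = q k := by
    refine eq_of_lqNorm_le (hq j) (hmono hjk') (C := ‖T‖ * C) hc fun m => ?_
    have h1 := hf m fun _ => 1
    simp only [norm_one] at h1
    refine h1.1.trans ((hTsum m _).trans ?_)
    rw [mul_assoc]
    exact mul_le_mul_of_nonneg_left h1.2 (norm_nonneg _)
  rw [← hqeq] at hf
  have hXj : ContainsLq 𝕜 (X j.castSucc) (q j) :=
    containsLq_of_sequence (f := fun i => T (f i)) (C := ‖T‖ * C) (hq j) hc
      (fun m a => (hf m a).1) fun m a => (hTsum m a).trans (by
        rw [mul_assoc]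
        exact mul_le_mul_of_nonneg_left (hf m a).2 (norm_nonneg _))
  have hXk : ContainsLq 𝕜 (X k.succ) (q j) :=
    containsLq_of_sequence (f := f) (c := c / (‖T‖ + 1)) (C := C) (hq j) (by positivity)
      (fun m a => by
        rw [div_mul_eq_mul_div, div_le_iff₀ (by positivity)]
        refine ((hf m a).1.trans (hTsum m a)).trans ?_
        nlinarith [norm_nonneg (∑ i ∈ Finset.range m, a i • f i)])
      fun m a => (hf m a).2
  rcases (hest j).2.2 with h | h
  · exact h hXj
  rcases hjk'.eq_or_lt with rfl | hlt
  · exact h hXk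
  -- Here `X j.succ` lies strictly between the two spaces. Its lower exponent `q i` is squeezed
  -- between `q j` and `q k`, so it equals its upper exponent `q j`.
  refine h ?_
  have hi : (j : ℕ) + 1 < n := lt_of_le_of_lt (Nat.succ_le_of_lt hlt) k.2
  let i : Fin n := ⟨j + 1, hi⟩
  have hqi : q i = q j := le_antisymm
    ((hmono (show i ≤ k from Nat.succ_le_of_lt hlt)).trans hqeq.ge)
    (hmono (show j ≤ i from Nat.le_succ j))
  have hlow : LowerEstimate (B j.succ) (q i) := (hest i).1
  rw [hqi] at hlow
  refine containsLq_of_estimates (hq j) (hX _ (Fin.succ_ne_zero j) fun e => ?_) hlow (hest j).2.1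
  have := congrArg Fin.val e
  simp at this
  omega

end Disjointness

end SplitUB

end

theorem mainTheorem2 {𝕜 : Type*} [RCLike 𝕜] {n : ℕ} {X : Fin (n + 1) → Type*}
    [∀ j, NormedAddCommGroup (X j)] [∀ j, NormedSpace 𝕜 (X j)] [∀ j, CompleteSpace (X j)]
    {ι : Fin (n + 1) → Type*} [∀ j, Countable (ι j)]
    (hX : ∀ j, j ≠ 0 → j ≠ Fin.last n → ¬ FiniteDimensional 𝕜 (X j))
    (B : ∀ j, UnconditionalSchauderBasis (ι j) 𝕜 (X j))
    (hB : SplitUB.LatticeEstimateDisjoint B) :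
    SplitUB.SplittingForUnconditionalBases 𝕜 X ∧
      ((∀ j, SplitUB.HasUTAPBasis 𝕜 (X j)) → SplitUB.HasUTAPBasis 𝕜 (∀ j, X j)) := by
  have hs : SplitUB.SplittingForUnconditionalBases 𝕜 X :=
    SplitUB.splitting_of_isCompactOperator
      (SplitUB.isCompactOperator_of_latticeEstimateDisjoint hX hB)
  exact ⟨hs, SplitUB.hasUTAPBasis_pi hs⟩
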